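/- Let $\mathbb S$ be a standard Borel space, $G_0$ a non-atomic probability measure on $\mathbb S$, $\theta>0$, and let $P\sim\mathrm{DP}(\theta,G_0)$ be a Dirichlet process, that is, $P=\tilde\mu/\tilde\mu(\mathbb S)$ with $\tilde\mu=\sum_{k}J_k\delta_{S_k}$, where $\sum_k\delta_{(J_k,S_k)}$ is a Poisson random measure on $(0,\infty)\times\mathbb S$ with intensity $\theta\,x^{-1}e^{-x}\,dx\,G_0(ds)$. Let $n,J\ge1$ and let $h:\mathbb S\to\{1,\dots,J\}$ be a (jointly measurable) random hash function, independent of $P$, drawn from a strongly universal family in the sense that, for two independent symbols $X,X'\sim G_0$ independent of $h$, the pair $(h(X),h(X'))$ is uniform on $\{1,\dots,J\}^2$. Let $\mathbf c=(c_1,\dots,c_J)$ be a vector of non-negative integers with $\sum_j c_j=n$. For a probability measure $P$ and a hash function $h$, let $X_1,\dots,X_{n+1}$ be i.i.d. from $P$ and put $C_j=\#\{i\le n: h(X_i)=j\}$, $f_{X_{n+1}}=\#\{i\le n: X_i=X_{n+1}\}$, $q_j(P)=P(h^{-1}\{j\})$, $$\pi_j(r;P)=\Pr[f_{X_{n+1}}=r\mid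 \mathbf C_J=\mathbf c,\ h(X_{n+1})=j],$$ $$\varepsilon_k(q;P)=n\sum_{j=1}^J q_j\sum_{r=0}^{c_j}\frac{1}{r+1}\,\pi_j(r;P),$$ and let $\varepsilon_k(P)=\varepsilon_k(q(P);P)$ be the Good–Turing form of the conditional expectation, given the sketch $\mathbf C_J=\mathbf c$, of the number of distinct symbols among $X_1,\dots,X_n$. Then, for almost every $h$, the smoothed cardinality estimator $\hat K_n^{(\mathrm{DP})}$, obtained by averaging $\varepsilon_k(P)$ over $P\sim\mathrm{DP}(\theta,G_0)$ with the bucket probabilities $q_j$ held fixed, is $$\hat K_n^{(\mathrm{DP})}=n\,\frac{\theta}{J}\sum_{j=1}^J\frac{q_j}{1+c_j}\left(\psi\!\left(1+c_j+\frac{\theta}{J}\right)-\psi\!\left(\frac{\theta}{J}\right)\right),$$ where $\psi=(\log\Gamma)'$ is the digamma function, in both of the following senses: (i) $\mathbb E_{P\sim\mathrm{DP}(\theta,G_0)}[\varepsilon_k(q;P)]$ exists and equals the right-hand side for every fixed $q\in\mathbb R^J$ (in particular, for every probability vector $q$); (ii) $\varepsilon_k(P)$ is integrable and its conditional expectation given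 the random vector $q(P)=(q_1(P),\dots,q_J(P))$ is almost surely equal to the right-hand side with $q_j=q_j(P)$. -/

import Mathlib

open MeasureTheory ProbabilityTheory Set
open scoped ENNReal

noncomputable section

namespace SketchDP

/-- The digamma function on the positive half-line: the derivative of `log Γ`. -/
def digamma (x : ℝ) : ℝ := deriv (fun y : ℝ => Real.log (Real.Gamma y)) x

/-! ### The Dirichlet process as a normalized Gamma completely random measure -/

section RandomMeasures

variable {Ω E S : Type*} [MeasurableSpace Ω] [MeasurableSpace E] [MeasurableSpace S]

/-- `N` is a Poisson random measure on `E` with intensity `ν`: the counts of measurable sets are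
Poisson distributed with parameter `ν A` (and a.s. infinite if `ν A = ∞`), and the counts of
pairwise disjoint sets are independent. -/
structure IsPoissonRandomMeasure (μ : Measure Ω) (N : Ω → Measure E) (ν : Measure E) : Prop where
  measurable : Measurable N
  count_law : ∀ A : Set E, MeasurableSet A → ν A ≠ ∞ →
    ∀ k : ℕ, μ {ω | N ω A = (k : ℝ≥0∞)} = poissonMeasure (ν A).toNNReal {k}
  count_infinite : ∀ A : Set E, MeasurableSet A → ν A = ∞ → ∀ᵐ ω ∂μ, N ω A = ∞
  indep : ∀ (m : ℕ) (A : Fin m → Set E), (∀ i, MeasurableSet (A i)) →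
    Pairwise (Function.onFun Disjoint A) → iIndepFun (fun i ω => N ω (A i)) μ

/-- The Lévy intensity `ν(dx, ds) = θ (e^{-x} / x) dx G₀(ds)` of the Gamma process, on the half
space `x > 0`. -/
def gammaIntensity (θ : ℝ) (G₀ : Measure S) : Measure (ℝ × S) :=
  ENNReal.ofReal θ • (((volume.restrict (Ioi (0 : ℝ))).withDensity
    (fun x => ENNReal.ofReal (Real.exp (-x) / x))).prod G₀)

/-- The point measure `∑ₖ δ_(Jₖ, Sₖ)` of a sequence of points `(Jₖ, Sₖ)`. -/
def pointMeasure (p : ℕ → ℝ × S) : Measure (ℝ × S) :=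
  Measure.sum fun k => Measure.dirac (p k)

/-- The discrete measure `∑ₖ Jₖ δ_Sₖ` with jumps `Jₖ` and locations `Sₖ`. -/
def jumpMeasure (p : ℕ → ℝ × S) : Measure S :=
  Measure.sum fun k => ENNReal.ofReal (p k).1 • Measure.dirac (p k).2

/-- `Q` is the law `DP(θ, G₀)` on the space of measures on `S`: the law of `μ̃ / μ̃(S)`, where
`μ̃ = ∑ₖ Jₖ δ_Sₖ` and `∑ₖ δ_(Jₖ, Sₖ)` is a Poisson random measure with the Gamma intensity.
(The law does not depend on the probability space that carries the points.) -/
def IsDirichletProcessLaw (θ : ℝ) (G₀ : Measure S) (Q : Measure (Measure S)) : Prop :=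
  ∃ (Ω : Type) (_ : MeasurableSpace Ω) (μ : Measure Ω) (_ : IsProbabilityMeasure μ)
    (p : ℕ → Ω → ℝ × S), (∀ k, Measurable (p k)) ∧
    IsPoissonRandomMeasure μ (fun ω => pointMeasure fun k => p k ω) (gammaIntensity θ G₀) ∧
    Q = μ.map (fun ω =>
      (jumpMeasure (fun k => p k ω) univ)⁻¹ • jumpMeasure (fun k => p k ω))

end RandomMeasures

/-! ### Random hashing -/

section Hash

variable {S H : Type*} [MeasurableSpace S] [MeasurableSpace H] {J : ℕ}

/-- Strong universality (pairwise independence and uniformity) of a random hash function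
`s ↦ h ι s`, `ι ∼ lam`, tested on pairs of independent symbols drawn from `G₀`, independently of
the hash function: the two hash values are independent and uniform on the `J` buckets. -/
def IsStronglyUniversalFor (lam : Measure H) (h : H → S → Fin J) (G₀ : Measure S) : Prop :=
  ∀ j₁ j₂ : Fin J,
    (lam.prod (G₀.prod G₀)) {z | h z.1 z.2.1 = j₁ ∧ h z.1 z.2.2 = j₂} = ((J : ℝ≥0∞) ^ 2)⁻¹

/-- Strong universality on all pairs of distinct fixed symbols implies the property above, for
every non-atomic `G₀`: two independent symbols from `G₀` are a.s. distinct. -/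
theorem IsStronglyUniversalFor.of_pairwise [MeasurableEq S] (lam : Measure H)
    [IsProbabilityMeasure lam] (h : H → S → Fin J) (hh : Measurable (Function.uncurry h))
    (G₀ : Measure S) [IsProbabilityMeasure G₀] [NullSingletonClass G₀]
    (hpair : ∀ s t : S, s ≠ t → ∀ j₁ j₂ : Fin J,
      lam {ι | h ι s = j₁ ∧ h ι t = j₂} = ((J : ℝ≥0∞) ^ 2)⁻¹) :
    IsStronglyUniversalFor lam h G₀ := by
  intro j₁ j₂
  have h1 : Measurable fun z : H × S × S => h z.1 z.2.1 :=
    hh.comp (measurable_fst.prodMk (measurable_fst.comp measurable_snd))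
  have h2 : Measurable fun z : H × S × S => h z.1 z.2.2 :=
    hh.comp (measurable_fst.prodMk (measurable_snd.comp measurable_snd))
  have hm : MeasurableSet {z : H × S × S | h z.1 z.2.1 = j₁ ∧ h z.1 z.2.2 = j₂} :=
    (h1 (measurableSet_singleton j₁)).inter (h2 (measurableSet_singleton j₂))
  have hd : ∀ᵐ y ∂(G₀.prod G₀), y.1 ≠ y.2 := by
    have hD : MeasurableSet {y : S × S | y.1 = y.2} := measurableSet_eq_fun
      measurable_fst measurable_snd
    rw [ae_iff]
    simp only [ne_eq, not_not]
    rw [Measure.prod_apply hD]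
    simp
  rw [Measure.prod_apply_symm hm, lintegral_congr_ae (g := fun _ => ((J : ℝ≥0∞) ^ 2)⁻¹)]
  · simp
  · filter_upwards [hd] with y hy
    exact hpair y.1 y.2 hy j₁ j₂

end Hash

/-! ### Sampling, the sketch, and the cardinality functional -/

section Sketch

variable {S : Type*} {J n : ℕ}

open Classical in
/-- The sketch `C_j = ∑_{i ≤ n} I[h(x_i) = j]` of the first `n` entries of `(x_1, …, x_{n+1})`. -/
def sketch (h : S → Fin J) (x : Fin (n + 1) → S) (j : Fin J) : ℕ :=
  (Finset.univ.filter fun i : Fin n => h (x i.castSucc) = j).card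

open Classical in
/-- The empirical frequency `f_{x_{n+1}}` of `x_{n+1}` among `x_1, …, x_n`. -/
def queryFrequency (x : Fin (n + 1) → S) : ℕ :=
  (Finset.univ.filter fun i : Fin n => x i.castSucc = x (Fin.last n)).card

variable [MeasurableSpace S]

/-- `π_j(r; P) = Pr[f_{X_{n+1}} = r | C_J = c, h(X_{n+1}) = j]` for `X_1, …, X_{n+1}` i.i.d.
from `P` and the hash function `h`. -/
def frequencyProb (h : S → Fin J) (n : ℕ) (c : Fin J → ℕ) (j : Fin J) (r : ℕ)
    (P : Measure S) : ℝ :=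
  (cond (Measure.pi fun _ : Fin (n + 1) => P)
    {x | sketch h x = c ∧ h (x (Fin.last n)) = j}).real {x | queryFrequency x = r}

/-- The bucket probability `q_j = Pr[h(X_i) = j]`, `X_i ∼ P`. -/
def bucketProb (h : S → Fin J) (P : Measure S) (j : Fin J) : ℝ := P.real (h ⁻¹' {j})

/-- The functional `n ∑_j q_j ∑_{r=0}^{c_j} π_j(r; P) / (r + 1)`, with the bucket probabilities
`q` as a separate argument. -/
def cardinalityFunctional (h : S → Fin J) (n : ℕ) (c : Fin J → ℕ) (q : Fin J → ℝ)
    (P : Measure S) : ℝ :=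
  n * ∑ j, q j * ∑ r ∈ Finset.range (c j + 1), 1 / ((r : ℝ) + 1) * frequencyProb h n c j r P

/-- `ε_k(P)`, the Good-Turing form of the conditional expectation of the number of distinct
symbols given the sketch: the functional above at the bucket probabilities of `P` itself. -/
def epsilonK (h : S → Fin J) (n : ℕ) (c : Fin J → ℕ) (P : Measure S) : ℝ :=
  cardinalityFunctional h n c (bucketProb h P) P

end Sketch

end SketchDP

end

open SketchDP

noncomputable section

namespace SketchDP

open Filter Topology
open scoped NNReal BoundedContinuousFunction

/-! By strong universality the `G₀`-mass of a bucket, as a function of the random hash, has mean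
`1/J` and second moment `1/J²`. Its variance is zero, so almost every `h` splits `G₀` into buckets
of mass exactly `1/J`. Fix such an `h` and put `α = θ/J`.

For a fixed `P`, let `M_i = ∫_{h = j} P{s}^i P(ds)`, the sum of the `(i+1)`-st powers of the atoms
in bucket `j` when `P` is discrete. Given the sketch and `h(X_{n+1}) = j`, the generating function
of the frequency is `∫_{h = j} (q_j - (1-u) P{s})^{c_j} P(ds) / q_j^{c_j + 1}`: the number of bucket
assignments and the other buckets cancel. Integrating over `u ∈ [0, 1]` turns the Good–Turing
weights `1/(r+1)` into `∑_i C(c_j, i) (-1)^i / (i+1) · M_i / q_j^{i+1}`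
(`sum_div_mul_frequencyProb`).

The ratio `M_i / q_j^{i+1}` is invariant under scaling, so it can be computed with the unnormalized
Gamma process. The Mecke formula gives the Laplace transform of the bucket masses `T` under the law
weighted by the power sum `R` of the jumps in bucket `j`. It agrees with that of independent Gamma
variables weighted by `w_i T_j^{i+1}`, where `w_i = α i! Γ(α) / Γ(α+i+1)`. Uniqueness of Laplace
transforms yields `E[R | T] = w_i T_j^{i+1}` (`map_withDensity_bucketMass`), so the ratio has
conditional mean `w_i` given all bucket masses, and hence given `q(P)`.

The alternating sum `∑_i C(m, i) (-1)^i / (i+1) · w_i` equals `α/(1+m) · ∑_{i ≤ m} 1/(i+α)`, a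
digamma difference (`sum_choose_div_mul_weightMoment`). Since this conditional mean is a constant,
fixing `q` and conditioning on `q(P)` give the same formula. -/

/-- The function `x ↦ e^{-x}` on `[0, ∞]`. -/
def expNeg (x : ℝ≥0∞) : ℝ≥0∞ := EReal.exp (-(x : EReal))

@[simp] lemma expNeg_zero : expNeg 0 = 1 := by simp [expNeg]

@[simp] lemma expNeg_top : expNeg ∞ = 0 := by simp [expNeg]

lemma expNeg_coe (x : ℝ≥0) : expNeg x = ENNReal.ofReal (Real.exp (-x)) := by
  simp only [expNeg]
  rw [← EReal.exp_coe]; rfl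

lemma expNeg_ofReal {x : ℝ} (hx : 0 ≤ x) :
    expNeg (ENNReal.ofReal x) = ENNReal.ofReal (Real.exp (-x)) := by
  rw [ENNReal.ofReal, expNeg_coe, Real.coe_toNNReal x hx]

lemma expNeg_add (x y : ℝ≥0∞) : expNeg (x + y) = expNeg x * expNeg y := by
  rw [expNeg, expNeg, expNeg, ← EReal.exp_add, EReal.coe_ennreal_add, EReal.neg_add]
  · rfl
  · left; simp
  · right; simp

lemma antitone_expNeg : Antitone expNeg := fun _ _ hxy =>
  EReal.exp_monotone (EReal.neg_le_neg_iff.2 (EReal.coe_ennreal_le_coe_ennreal_iff.2 hxy))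

lemma expNeg_le_one (x : ℝ≥0∞) : expNeg x ≤ 1 := by
  simpa using antitone_expNeg (zero_le (a := x))

lemma expNeg_ne_top (x : ℝ≥0∞) : expNeg x ≠ ∞ :=
  ne_top_of_le_ne_top ENNReal.one_ne_top (expNeg_le_one x)

lemma expNeg_eq_one_iff {x : ℝ≥0∞} : expNeg x = 1 ↔ x = 0 := by
  rw [expNeg, ← EReal.exp_zero, EReal.exp_strictMono.injective.eq_iff]
  simp

lemma continuous_expNeg : Continuous expNeg :=
  ENNReal.continuous_exp.comp (continuous_neg.comp continuous_coe_ennreal_ereal)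

@[fun_prop] lemma measurable_expNeg : Measurable expNeg := continuous_expNeg.measurable

lemma expNeg_sum {ι : Type*} (s : Finset ι) (f : ι → ℝ≥0∞) :
    expNeg (∑ i ∈ s, f i) = ∏ i ∈ s, expNeg (f i) := by
  classical
  induction s using Finset.induction_on with
  | empty => simp
  | insert a s ha ih => rw [Finset.sum_insert ha, Finset.prod_insert ha, expNeg_add, ih]

lemma expNeg_mul_nat (x : ℝ≥0∞) (k : ℕ) : expNeg (x * k) = expNeg x ^ k := by
  induction k with
  | zero => simp
  | succ k ih => rw [Nat.cast_succ, mul_add, mul_one, expNeg_add, ih, pow_succ]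

/-! ### Laplace functional and Mecke formula of a Poisson random measure. -/

section Laplace

variable {Ω E : Type*} [MeasurableSpace Ω] [MeasurableSpace E] {μ : Measure Ω}
  [IsProbabilityMeasure μ] {N : Ω → Measure E} {ν : Measure E}

omit [IsProbabilityMeasure μ] in
lemma IsPoissonRandomMeasure.measurable_apply (hN : IsPoissonRandomMeasure μ N ν) {A : Set E}
    (hA : MeasurableSet A) : Measurable fun ω => N ω A :=
  (Measure.measurable_coe hA).comp hN.measurable

omit [IsProbabilityMeasure μ] in
lemma IsPoissonRandomMeasure.measurable_lintegral (hN : IsPoissonRandomMeasure μ N ν)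
    {f : E → ℝ≥0∞} (hf : Measurable f) : Measurable fun ω => ∫⁻ x, f x ∂(N ω) :=
  (Measure.measurable_lintegral hf).comp hN.measurable

/-- The Poisson probability generating function, later used with `y = e^{-x}`. -/
lemma tsum_pow_mul_poissonMeasure (r : ℝ≥0) (y : ℝ≥0) (hy : y ≤ 1) :
    ∑' k : ℕ, (y : ℝ≥0∞) ^ k * poissonMeasure r {k} = expNeg (r * (1 - y)) := by
  have h1 : ∀ k : ℕ, (y : ℝ≥0∞) ^ k * poissonMeasure r {k} =
      ENNReal.ofReal (Real.exp (-r) * ((r * y : ℝ) ^ k / k.factorial)) := by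
    intro k
    rw [poissonMeasure_singleton, ← ENNReal.ofReal_coe_nnreal (p := y),
      ← ENNReal.ofReal_pow (by positivity), ← ENNReal.ofReal_mul (by positivity)]
    congr 1
    rw [mul_pow]; ring
  have hs : HasSum (fun k : ℕ => Real.exp (-r) * ((r * y : ℝ) ^ k / k.factorial))
      (Real.exp (-r) * Real.exp (r * y)) := by
    have := NormedSpace.expSeries_div_hasSum_exp (r * y : ℝ)
    rw [← Real.exp_eq_exp_ℝ] at this
    exact this.mul_left _
  simp_rw [h1]
  rw [← ENNReal.ofReal_tsum_of_nonneg (fun k => by positivity) hs.summable, hs.tsum_eq]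
  have h2 : (r : ℝ≥0∞) * (1 - y) = ((r * (1 - y) : ℝ≥0) : ℝ≥0∞) := by push_cast; rfl
  rw [h2, expNeg_coe, ← Real.exp_add]
  congr 2
  rw [NNReal.coe_mul, NNReal.coe_sub hy]; push_cast; ring

/-- An infinite intensity makes the count infinite almost surely, so both sides vanish, except at `x
= 0` where `0 * ∞ = 0` makes both equal to 1. A finite intensity reduces to the Poisson generating
function. -/
lemma IsPoissonRandomMeasure.lintegral_expNeg_mul (hN : IsPoissonRandomMeasure μ N ν)
    {A : Set E} (hA : MeasurableSet A) (x : ℝ≥0∞) :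
    ∫⁻ ω, expNeg (x * N ω A) ∂μ = expNeg ((1 - expNeg x) * ν A) := by
  by_cases hν : ν A = ∞
  · rcases eq_or_ne x 0 with rfl | hx
    · simp
    · rw [hν, ENNReal.mul_top, expNeg_top]
      · rw [lintegral_congr_ae (g := fun _ => 0)]
        · simp
        · filter_upwards [hN.count_infinite A hA hν] with ω hω
          rw [hω, ENNReal.mul_top hx, expNeg_top]
      · rw [ne_eq, tsub_eq_zero_iff_le, not_le]
        exact lt_of_le_of_ne (expNeg_le_one x) fun h => hx (expNeg_eq_one_iff.1 h)
  · set r := (ν A).toNNReal with hr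
    have hm : ∀ k : ℕ, MeasurableSet {ω | N ω A = (k : ℝ≥0∞)} := fun k =>
      hN.measurable_apply hA (measurableSet_singleton _)
    have hd : Pairwise (Function.onFun Disjoint fun k : ℕ => {ω | N ω A = (k : ℝ≥0∞)}) := by
      intro k l hkl
      refine Set.disjoint_left.2 fun ω h1 h2 => hkl ?_
      simp only [mem_ofPred_eq] at h1 h2
      exact_mod_cast h1.symm.trans h2
    have hlaw := hN.count_law A hA hν
    -- `count_law` does not say outright that the count is almost surely an integer; this follows
    -- because the Poisson masses sum to 1.
    have hfull : μ (⋃ k : ℕ, {ω | N ω A = (k : ℝ≥0∞)}) = 1 := by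
      rw [measure_iUnion hd hm]
      simp_rw [hlaw]
      have := tsum_pow_mul_poissonMeasure r 1 le_rfl
      simpa using this
    have hrest : μ.restrict (⋃ k : ℕ, {ω | N ω A = (k : ℝ≥0∞)}) = μ := by
      rw [Measure.restrict_eq_self_of_ae_mem]
      rw [ae_iff]
      exact (prob_compl_eq_zero_iff (MeasurableSet.iUnion hm)).2 hfull
    rw [← hrest, lintegral_iUnion hm hd]
    have h1 : ∀ k : ℕ, ∫⁻ ω in {ω | N ω A = (k : ℝ≥0∞)}, expNeg (x * N ω A) ∂μ =
        ((expNeg x).toNNReal : ℝ≥0∞) ^ k * poissonMeasure r {k} := by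
      intro k
      rw [setLIntegral_congr_fun (g := fun _ => expNeg x ^ k) (hm k), setLIntegral_const, hlaw,
        ENNReal.coe_toNNReal (expNeg_ne_top x)]
      intro ω hω
      simp only [mem_ofPred_eq] at hω
      simp only [hω, expNeg_mul_nat]
    simp_rw [h1]
    rw [tsum_pow_mul_poissonMeasure, hr, ENNReal.coe_toNNReal hν,
      ENNReal.coe_toNNReal (expNeg_ne_top x), mul_comm]
    exact ENNReal.toNNReal_mono ENNReal.one_ne_top (expNeg_le_one x)

/-- The fibres of `g` are disjoint, so their counts are independent and the exponential of the
integral factorizes over them. -/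
lemma IsPoissonRandomMeasure.lintegral_expNeg_simpleFunc (hN : IsPoissonRandomMeasure μ N ν)
    (g : SimpleFunc E ℝ≥0∞) :
    ∫⁻ ω, expNeg (∫⁻ x, g x ∂(N ω)) ∂μ = expNeg (∫⁻ x, (1 - expNeg (g x)) ∂ν) := by
  let e := g.range.equivFin.symm
  let A : Fin g.range.card → Set E := fun i => g ⁻¹' {(e i : ℝ≥0∞)}
  have hA : ∀ i, MeasurableSet (A i) := fun i => g.measurableSet_fiber _
  have hdis : Pairwise (Function.onFun Disjoint A) := by
    intro i j hij
    refine Set.disjoint_left.2 fun x h1 h2 => hij ?_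
    have h3 : (e i : ℝ≥0∞) = e j := by
      rw [← show g x = e i from h1, ← show g x = e j from h2]
    exact e.injective (Subtype.ext h3)
  have hsum : ∀ (F : ℝ≥0∞ → Set E → ℝ≥0∞),
      ∑ x ∈ g.range, F x (g ⁻¹' {x}) = ∑ i, F (e i) (A i) := by
    intro F
    rw [← Finset.sum_coe_sort g.range (fun x => F x (g ⁻¹' {x})), ← Equiv.sum_comp e]
  have h1 : ∀ ω, expNeg (∫⁻ x, g x ∂(N ω)) = ∏ i, expNeg (e i * N ω (A i)) := by
    intro ω
    rw [SimpleFunc.lintegral_eq_lintegral, SimpleFunc.lintegral,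
      hsum (fun x B => x * N ω B), expNeg_sum]
  simp_rw [h1]
  have hind := (hN.indep _ A hA hdis).comp (fun i y => expNeg (e i * y)) (fun i => by fun_prop)
  have h2 := lintegral_prod_eq_prod_lintegral_of_indepFun Finset.univ
    (fun i ω => expNeg (e i * N ω (A i))) hind
    (fun i => measurable_expNeg.comp ((hN.measurable_apply (hA i)).const_mul _))
  rw [h2]
  simp_rw [hN.lintegral_expNeg_mul (hA _)]
  rw [← expNeg_sum, ← hsum (fun x B => (1 - expNeg x) * ν B)]
  congr 1
  have h3 : (fun x => 1 - expNeg (g x)) = g.map (fun y => 1 - expNeg y) := by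
    ext x; simp
  rw [h3, SimpleFunc.lintegral_eq_lintegral, SimpleFunc.map_lintegral]

/-- The Laplace functional of a Poisson random measure. -/
lemma IsPoissonRandomMeasure.lintegral_expNeg (hN : IsPoissonRandomMeasure μ N ν)
    {g : E → ℝ≥0∞} (hg : Measurable g) :
    ∫⁻ ω, expNeg (∫⁻ x, g x ∂(N ω)) ∂μ = expNeg (∫⁻ x, (1 - expNeg (g x)) ∂ν) := by
  have hlim : ∀ x, Tendsto (fun m => SimpleFunc.eapprox g m x) atTop (𝓝 (g x)) := fun x => by
    have := tendsto_atTop_iSup (f := fun m => SimpleFunc.eapprox g m x)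
      (fun i j hij => SimpleFunc.monotone_eapprox g hij x)
    rwa [SimpleFunc.iSup_eapprox_apply hg] at this
  -- The left side converges by domination by 1. The right side converges monotonically, since `1 -
  -- e^{-g}` increases with `g`; no finiteness of `ν` is needed.
  have hL : Tendsto (fun m => ∫⁻ ω, expNeg (∫⁻ x, SimpleFunc.eapprox g m x ∂(N ω)) ∂μ) atTop
      (𝓝 (∫⁻ ω, expNeg (∫⁻ x, g x ∂(N ω)) ∂μ)) := by
    refine tendsto_lintegral_of_dominated_convergence (fun _ => 1) (fun m => ?_) (fun m => ?_)
      (by simp) ?_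
    · exact measurable_expNeg.comp (hN.measurable_lintegral (SimpleFunc.eapprox g m).measurable)
    · exact ae_of_all _ fun ω => expNeg_le_one _
    · refine ae_of_all _ fun ω => (continuous_expNeg.tendsto _).comp ?_
      exact lintegral_tendsto_of_tendsto_of_monotone
        (fun m => (SimpleFunc.eapprox g m).measurable.aemeasurable)
        (ae_of_all _ fun x i j hij => SimpleFunc.monotone_eapprox g hij x)
        (ae_of_all _ hlim)
  have hR : Tendsto (fun m => expNeg (∫⁻ x, (1 - expNeg (SimpleFunc.eapprox g m x)) ∂ν)) atTop
      (𝓝 (expNeg (∫⁻ x, (1 - expNeg (g x)) ∂ν))) := by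
    refine (continuous_expNeg.tendsto _).comp ?_
    refine lintegral_tendsto_of_tendsto_of_monotone
        (fun m => (measurable_const.sub
          (measurable_expNeg.comp (SimpleFunc.eapprox g m).measurable)).aemeasurable)
        (ae_of_all _ fun x i j hij => tsub_le_tsub_left
          (antitone_expNeg (SimpleFunc.monotone_eapprox g hij x)) _)
        (ae_of_all _ fun x => ?_)
    exact ENNReal.Tendsto.sub tendsto_const_nhds ((continuous_expNeg.tendsto _).comp (hlim x))
      (Or.inl ENNReal.one_ne_top)
  refine tendsto_nhds_unique hL ?_
  simp_rw [hN.lintegral_expNeg_simpleFunc]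
  exact hR

/-- The difference quotient `(1 - e^{-b t}) / t` at `t = 1 / (m + 1)`. -/
def expQuot (m : ℕ) (b : ℝ≥0∞) : ℝ≥0∞ := (m + 1) * (1 - expNeg ((m + 1 : ℝ≥0∞)⁻¹ * b))

lemma expQuot_coe (m : ℕ) (b : ℝ≥0) :
    expQuot m b = ENNReal.ofReal ((m + 1) * (1 - Real.exp (-((m + 1 : ℝ)⁻¹ * b)))) := by
  have h1 : (m + 1 : ℝ≥0∞)⁻¹ * b = ENNReal.ofReal ((m + 1 : ℝ)⁻¹ * b) := by
    rw [ENNReal.ofReal_mul (by positivity), ENNReal.ofReal_inv_of_pos (by positivity),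
      ENNReal.ofReal_add (by positivity) zero_le_one]
    simp
  rw [expQuot, h1, expNeg_ofReal (by positivity), ENNReal.ofReal_mul (by positivity),
    ENNReal.ofReal_sub _ (Real.exp_nonneg _), ENNReal.ofReal_add (by positivity) zero_le_one]
  simp

lemma expQuot_top (m : ℕ) : expQuot m ∞ = m + 1 := by
  have : (m + 1 : ℝ≥0∞)⁻¹ ≠ 0 := by simp
  rw [expQuot, ENNReal.mul_top this]; simp

/-- Convexity of `exp`: `-b/(m+2)` is the convex combination of `0` and `-b/(m+1)` with weights
`1/(m+2)` and `(m+1)/(m+2)`. Monotonicity lets the derivative at `0` be taken by monotone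
convergence, with infinite values allowed. -/
lemma monotone_expQuot_left (b : ℝ≥0∞) : Monotone fun m => expQuot m b := by
  refine monotone_nat_of_le_succ fun m => ?_
  induction b using ENNReal.recTopCoe with
  | top =>
    simp only [expQuot_top]
    gcongr
    simp
  | coe b =>
    simp only [expQuot_coe]
    refine ENNReal.ofReal_le_ofReal ?_
    have hm : (0 : ℝ) < m + 1 := by positivity
    have hm' : (0 : ℝ) < m + 2 := by positivity
    have hc := convexOn_exp.2 (mem_univ 0) (mem_univ (-((m + 1 : ℝ)⁻¹ * b)))
      (show (0 : ℝ) ≤ 1 / (m + 2 : ℝ) by positivity)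
      (show (0 : ℝ) ≤ (m + 1) / (m + 2 : ℝ) by positivity) (by field_simp; ring)
    simp only [smul_eq_mul, mul_zero, zero_add, Real.exp_zero, mul_one] at hc
    have he : (m + 1) / (m + 2 : ℝ) * -((m + 1 : ℝ)⁻¹ * b) = -((m + 2 : ℝ)⁻¹ * b) := by
      field_simp
    rw [he] at hc
    have h2 : ((m + 1 : ℕ) : ℝ) + 1 = m + 2 := by push_cast; ring
    rw [h2]
    have h3 := mul_le_mul_of_nonneg_left hc hm'.le
    have h4 : (m + 2 : ℝ) * (1 / (m + 2 : ℝ) +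
        (m + 1) / (m + 2 : ℝ) * Real.exp (-((m + 1 : ℝ)⁻¹ * b))) =
        1 + (m + 1) * Real.exp (-((m + 1 : ℝ)⁻¹ * b)) := by
      field_simp
    rw [h4] at h3
    linarith

lemma monotone_expQuot (m : ℕ) : Monotone (expQuot m) := fun a b hab => by
  unfold expQuot
  gcongr
  exact antitone_expNeg (by gcongr)

lemma continuous_expQuot (m : ℕ) : Continuous (expQuot m) := by
  have h1 : Continuous fun b : ℝ≥0∞ => (m + 1 : ℝ≥0∞)⁻¹ * b :=
    ENNReal.continuous_const_mul (by simp)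
  have h2 : Continuous fun b : ℝ≥0∞ => 1 - expNeg ((m + 1 : ℝ≥0∞)⁻¹ * b) :=
    (ENNReal.continuous_sub_left ENNReal.one_ne_top).comp (continuous_expNeg.comp h1)
  exact (ENNReal.continuous_const_mul (by simp)).comp h2

lemma tendsto_expQuot (b : ℝ≥0∞) : Tendsto (fun m => expQuot m b) atTop (𝓝 b) := by
  induction b using ENNReal.recTopCoe with
  | top =>
    simp only [expQuot_top]
    exact_mod_cast (ENNReal.tendsto_nat_nhds_top).comp (tendsto_add_atTop_nat 1)
  | coe b =>
    simp only [expQuot_coe]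
    rw [← ENNReal.ofReal_coe_nnreal]
    refine (ENNReal.continuous_ofReal.tendsto _).comp ?_
    have hd : HasDerivAt (fun t : ℝ => -Real.exp (-(t * b))) b 0 := by
      have := ((hasDerivAt_id (0 : ℝ)).mul_const (b : ℝ)).neg.exp.neg
      simpa [Pi.neg_def] using this
    have ht := hasDerivAt_iff_tendsto_slope_zero.1 hd
    have h0 : Tendsto (fun m : ℕ => ((m + 1 : ℝ))⁻¹) atTop (𝓝[≠] 0) := by
      refine tendsto_nhdsWithin_iff.2 ⟨?_, Eventually.of_forall fun m => ?_⟩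
      · simpa using tendsto_one_div_add_atTop_nhds_zero_nat (𝕜 := ℝ)
      · have : (0 : ℝ) < (m + 1 : ℝ)⁻¹ := by positivity
        exact this.ne'
    refine (ht.comp h0).congr fun m => ?_
    simp only [Function.comp_apply, smul_eq_mul, inv_inv, zero_add, zero_mul, neg_zero,
      Real.exp_zero]
    ring

lemma expQuot_le (m : ℕ) (b : ℝ≥0∞) : expQuot m b ≤ b :=
  (monotone_expQuot_left b).ge_of_tendsto (tendsto_expQuot b) m

/-- A diagonal limit: freezing the index of the quotient at `k` gives a lower bound for all `m ≥ k`,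
and then `k` goes to infinity. -/
lemma tendsto_expQuot_of_monotone {d : ℕ → ℝ≥0∞} (hd : Monotone d) {b : ℝ≥0∞}
    (hb : Tendsto d atTop (𝓝 b)) : Tendsto (fun m => expQuot m (d m)) atTop (𝓝 b) := by
  have hmono : Monotone fun m => expQuot m (d m) := fun i j hij =>
    (monotone_expQuot_left (d i) hij).trans (monotone_expQuot j (hd hij))
  have ht := tendsto_atTop_iSup hmono
  suffices h : ⨆ m, expQuot m (d m) = b by rwa [h] at ht
  refine le_antisymm (iSup_le fun m => (expQuot_le _ _).trans (hd.ge_of_tendsto hb m)) ?_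
  refine le_of_tendsto' (tendsto_expQuot b) fun k => ?_
  refine le_of_tendsto (((continuous_expQuot k).tendsto b).comp hb) ?_
  filter_upwards [eventually_ge_atTop k] with m hm
  exact (monotone_expQuot_left (d m) hm).trans (le_iSup (fun m => expQuot m (d m)) m)

/-- The Mecke formula of a Poisson random measure, for exponential functionals. -/
lemma IsPoissonRandomMeasure.lintegral_mul_expNeg (hN : IsPoissonRandomMeasure μ N ν)
    {f g : E → ℝ≥0∞} (hf : Measurable f) (hg : Measurable g) :
    ∫⁻ ω, expNeg (∫⁻ x, g x ∂(N ω)) * ∫⁻ x, f x ∂(N ω) ∂μ =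
      expNeg (∫⁻ x, (1 - expNeg (g x)) ∂ν) * ∫⁻ x, expNeg (g x) * f x ∂ν := by
  have hmA := hN.measurable_lintegral hg
  have hmB := hN.measurable_lintegral hf
  set A := fun ω => ∫⁻ x, g x ∂(N ω) with hA
  set B := fun ω => ∫⁻ x, f x ∂(N ω) with hB
  set Λ := ∫⁻ x, (1 - expNeg (g x)) ∂ν with hΛ
  have hmq : ∀ m, Measurable (expQuot m) := fun m => (continuous_expQuot m).measurable
  let d : ℕ → ℝ≥0∞ := fun m => ∫⁻ x, expNeg (g x) * expQuot m (f x) ∂ν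
  have hdmono : Monotone d := fun i j hij => lintegral_mono fun x =>
    mul_le_mul_right (monotone_expQuot_left (f x) hij) _
  have hdlim : Tendsto d atTop (𝓝 (∫⁻ x, expNeg (g x) * f x ∂ν)) := by
    refine lintegral_tendsto_of_tendsto_of_monotone
      (fun m => ((measurable_expNeg.comp hg).mul ((hmq m).comp hf)).aemeasurable)
      (ae_of_all _ fun x i j hij => mul_le_mul_right (monotone_expQuot_left (f x) hij) _)
      (ae_of_all _ fun x => ENNReal.Tendsto.const_mul (tendsto_expQuot _)
        (Or.inr (expNeg_ne_top _)))
  have hL : Tendsto (fun m => ∫⁻ ω, expNeg (A ω) * expQuot m (B ω) ∂μ) atTop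
      (𝓝 (∫⁻ ω, expNeg (A ω) * B ω ∂μ)) := by
    refine lintegral_tendsto_of_tendsto_of_monotone
      (fun m => ((measurable_expNeg.comp hmA).mul ((hmq m).comp hmB)).aemeasurable)
      (ae_of_all _ fun x i j hij => mul_le_mul_right (monotone_expQuot_left (B x) hij) _)
      (ae_of_all _ fun x => ENNReal.Tendsto.const_mul (tendsto_expQuot _)
        (Or.inr (expNeg_ne_top _)))
  have hR : Tendsto (fun m => expNeg Λ * expQuot m (d m)) atTop
      (𝓝 (expNeg Λ * ∫⁻ x, expNeg (g x) * f x ∂ν)) :=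
    ENNReal.Tendsto.const_mul (tendsto_expQuot_of_monotone hdmono hdlim) (Or.inr (expNeg_ne_top _))
  refine tendsto_nhds_unique hL (hR.congr fun m => ?_)
  -- The formula is the derivative at `t = 0` of the Laplace functional of `g + t f`. Both sides are
  -- compared at `t = 1/(m+1)`, where the difference quotients agree exactly.
  set t : ℝ≥0∞ := (m + 1 : ℝ≥0∞)⁻¹ with ht
  have hq : ∀ a b : ℝ≥0∞, a ≠ ∞ → a * expQuot m b = (m + 1) * (a - a * expNeg (t * b)) := by
    intro a b ha
    rw [expQuot, mul_left_comm, ENNReal.mul_sub fun _ _ => ha, mul_one]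
  have hd : t * d m = ∫⁻ x, (expNeg (g x) - expNeg (g x) * expNeg (t * f x)) ∂ν := by
    have hmd : Measurable fun x => expNeg (g x) * expQuot m (f x) :=
      (measurable_expNeg.comp hg).mul ((hmq m).comp hf)
    rw [← lintegral_const_mul _ hmd]
    refine lintegral_congr fun x => ?_
    rw [hq _ _ (expNeg_ne_top _), ← mul_assoc, ht, ENNReal.inv_mul_cancel (by simp) (by simp),
      one_mul]
  -- Telescoping: `(1 - e^{-g}) + (e^{-g} - e^{-g} e^{-tf}) = 1 - e^{-(g+tf)}`.
  have hsum : Λ + t * d m = ∫⁻ x, (1 - expNeg (g x + t * f x)) ∂ν := by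
    rw [hd, hΛ, ← lintegral_add_left (by fun_prop)]
    refine lintegral_congr fun x => ?_
    rw [expNeg_add, tsub_add_tsub_cancel (expNeg_le_one _)]
    exact mul_le_of_le_one_right' (expNeg_le_one _)
  have hE : ∫⁻ ω, expNeg (A ω) * expNeg (t * B ω) ∂μ = expNeg Λ * expNeg (t * d m) := by
    rw [← expNeg_add, hsum, ← hN.lintegral_expNeg (by fun_prop)]
    refine lintegral_congr fun ω => ?_
    rw [← expNeg_add, lintegral_add_left hg, lintegral_const_mul _ hf]
  have hE0 : ∫⁻ ω, expNeg (A ω) ∂μ = expNeg Λ := hN.lintegral_expNeg hg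
  rw [hq _ _ (expNeg_ne_top _), ← hE, ← hE0]
  simp_rw [hq _ _ (expNeg_ne_top _)]
  rw [lintegral_const_mul _ (by fun_prop), lintegral_sub (by fun_prop)]
  · rw [hE]
    exact ENNReal.mul_ne_top (expNeg_ne_top _) (expNeg_ne_top _)
  · exact ae_of_all _ fun ω => mul_le_of_le_one_right' (expNeg_le_one _)

end Laplace

/-! ### Uniqueness of Laplace transforms on the orthant, by Stone–Weierstrass. -/

section LaplaceUniqueness

variable {ι : Type*} [Fintype ι]

/-- The bounded continuous functions `t ↦ e^{-⟨a, t⟩}` on the orthant. -/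
def expNegHom : Multiplicative (ι → ℝ≥0) →* ((ι → ℝ≥0) →ᵇ ℝ) where
  toFun a := BoundedContinuousFunction.ofNormedAddCommGroup
    (fun t => Real.exp (-((∑ i, a.toAdd i * t i : ℝ≥0) : ℝ))) (by fun_prop) 1 (fun t => by
      rw [Real.norm_eq_abs, abs_of_pos (Real.exp_pos _), Real.exp_le_one_iff]
      simp only [Left.neg_nonpos_iff, NNReal.zero_le_coe])
  map_one' := by ext t; simp
  map_mul' a b := by
    ext t
    simp [add_mul, Finset.sum_add_distrib, ← Real.exp_add]
    ring

lemma expNegHom_apply (a : Multiplicative (ι → ℝ≥0)) (t : ι → ℝ≥0) :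
    expNegHom a t = Real.exp (-((∑ i, a.toAdd i * t i : ℝ≥0) : ℝ)) := rfl

/-- The linear span of the functions `t ↦ e^{-⟨a, t⟩}`, an algebra. -/
def expNegAlgebra (ι : Type*) [Fintype ι] : StarSubalgebra ℝ ((ι → ℝ≥0) →ᵇ ℝ) where
  toSubalgebra := Algebra.adjoin ℝ (MonoidHom.mrange (expNegHom (ι := ι)) : Set _)
  star_mem' := fun {f} hf => by
    have : star f = f := by ext t; simp
    rwa [this]

lemma toReal_lintegral_expNeg (μ : Measure (ι → ℝ≥0)) (a : Multiplicative (ι → ℝ≥0)) :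
    (∫⁻ t, expNeg (∑ i, (a.toAdd i : ℝ≥0∞) * t i) ∂μ).toReal = ∫ t, expNegHom a t ∂μ := by
  rw [integral_eq_lintegral_of_nonneg_ae (f := expNegHom a) (ae_of_all _ fun t => (Real.exp_pos _).le)
    (expNegHom a).continuous.aestronglyMeasurable]
  congr 1
  refine lintegral_congr fun t => ?_
  rw [expNegHom_apply, ← expNeg_coe]
  push_cast
  rfl

/-- A finite measure on the orthant is determined by its Laplace transform. -/
lemma ext_of_lintegral_expNeg {μ ν : Measure (ι → ℝ≥0)} [IsFiniteMeasure μ] [IsFiniteMeasure ν]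
    (h : ∀ a : ι → ℝ≥0, ∫⁻ t, expNeg (∑ i, (a i : ℝ≥0∞) * t i) ∂μ =
      ∫⁻ t, expNeg (∑ i, (a i : ℝ≥0∞) * t i) ∂ν) : μ = ν := by
  classical
  refine ext_of_forall_mem_subalgebra_integral_eq_of_pseudoEMetric_complete_countable
    (𝕜 := ℝ) (A := expNegAlgebra ι) ?_ fun g hg => ?_
  · intro s t hst
    obtain ⟨i, hi⟩ := Function.ne_iff.1 hst
    refine ⟨expNegHom (Multiplicative.ofAdd (Pi.single i 1)), ⟨_, ⟨_,
      Algebra.subset_adjoin ⟨Multiplicative.ofAdd (Pi.single i 1), rfl⟩, rfl⟩, rfl⟩, ?_⟩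
    rw [expNegHom_apply, expNegHom_apply]
    simpa [Pi.single_apply] using hi
  -- The exponentials are closed under products, so the algebra they generate is just their linear
  -- span, and linearity reduces the claim to single exponentials.
  · have hg' : g ∈ Submodule.span ℝ (MonoidHom.mrange (expNegHom (ι := ι)) : Set _) := by
      have h1 : g ∈ Subalgebra.toSubmodule
        (Algebra.adjoin ℝ (MonoidHom.mrange (expNegHom (ι := ι)) : Set _)) := hg
      rwa [Algebra.adjoin_eq_span, Submonoid.closure_eq] at h1
    clear hg
    induction hg' using Submodule.span_induction with
    | mem f hf =>
      obtain ⟨a, rfl⟩ := hf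
      rw [← toReal_lintegral_expNeg, ← toReal_lintegral_expNeg, h]
    | zero => simp
    | add f g _ _ hf hg =>
      simp only [BoundedContinuousFunction.coe_add, Pi.add_apply]
      rw [integral_add (f.integrable μ) (g.integrable μ),
        integral_add (f.integrable ν) (g.integrable ν), hf, hg]
    | smul r f _ hf =>
      simp only [BoundedContinuousFunction.coe_smul]
      rw [integral_smul, integral_smul, hf]

end LaplaceUniqueness

/-! ### Gamma laws and Frullani's integral. -/

section GammaIntegrals

lemma lintegral_rpow_mul_exp_neg {p r : ℝ} (hp : 0 < p) (hr : 0 < r) :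
    ∫⁻ x in Ioi (0 : ℝ), ENNReal.ofReal (x ^ (p - 1) * Real.exp (-(r * x))) =
      ENNReal.ofReal (Real.Gamma p / r ^ p) := by
  have h := Real.integral_rpow_mul_exp_neg_mul_Ioi hp hr
  have hpos : (0 : ℝ) < (1 / r) ^ p * Real.Gamma p :=
    mul_pos (by positivity) (Real.Gamma_pos_of_pos hp)
  -- The Bochner integral of a non-integrable function is 0, so a positive value proves
  -- integrability.
  have hi : Integrable (fun x : ℝ => x ^ (p - 1) * Real.exp (-(r * x)))
      (volume.restrict (Ioi 0)) := Integrable.of_integral_ne_zero (by rw [h]; exact hpos.ne')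
  rw [← ofReal_integral_eq_lintegral_ofReal hi, h, Real.div_rpow zero_le_one hr.le, Real.one_rpow]
  · congr 1; ring
  · filter_upwards [ae_restrict_mem measurableSet_Ioi] with x hx
    have : (0 : ℝ) < x := hx
    positivity

/-- The Gamma law with shape `α` and rate `1`, as a measure on `[0, ∞)`. -/
def gammaLaw (α : ℝ) : Measure ℝ≥0 :=
  ((volume.restrict (Ioi (0 : ℝ))).withDensity
    (fun x => ENNReal.ofReal (x ^ (α - 1) * Real.exp (-x) / Real.Gamma α))).map Real.toNNReal

/-- For `k = 0` this is the Laplace transform of the Gamma law; positive `k` gives that of the law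
weighted by a power of the variable. -/
lemma lintegral_gammaLaw {α : ℝ} (hα : 0 < α) (k : ℕ) (b : ℝ≥0) :
    ∫⁻ t : ℝ≥0, (t : ℝ≥0∞) ^ k * expNeg (b * t) ∂(gammaLaw α) =
      ENNReal.ofReal (Real.Gamma (α + k) / Real.Gamma α / (1 + b) ^ (α + k)) := by
  have hm : Measurable fun t : ℝ≥0 => (t : ℝ≥0∞) ^ k * expNeg (b * t) := by fun_prop
  have hΓ := Real.Gamma_pos_of_pos hα
  rw [gammaLaw, lintegral_map hm (by fun_prop),
    lintegral_withDensity_eq_lintegral_mul _ (by fun_prop) (by fun_prop),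
    setLIntegral_congr_fun (g := fun x => ENNReal.ofReal (1 / Real.Gamma α) *
      ENNReal.ofReal (x ^ (α + k - 1) * Real.exp (-((1 + b) * x)))) measurableSet_Ioi,
    lintegral_const_mul _ (by fun_prop), lintegral_rpow_mul_exp_neg (by positivity) (by positivity),
    ← ENNReal.ofReal_mul (by positivity)]
  · congr 1; field_simp
  · intro x (hx : 0 < x)
    have h1 : (b : ℝ≥0∞) * ENNReal.ofReal x = ENNReal.ofReal (b * x) := by
      rw [ENNReal.ofReal_mul (by positivity), ENNReal.ofReal_coe_nnreal]
    simp only [Pi.mul_apply]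
    change _ * (ENNReal.ofReal x ^ k * expNeg (b * ENNReal.ofReal x)) = _
    rw [h1, expNeg_ofReal (by positivity), ← ENNReal.ofReal_pow hx.le,
      ← ENNReal.ofReal_mul (by positivity), ← ENNReal.ofReal_mul (by positivity),
      ← ENNReal.ofReal_mul (by positivity)]
    congr 1
    have h2 : x ^ (α + k - 1) = x ^ (α - 1) * x ^ k := by
      rw [← Real.rpow_natCast x k, ← Real.rpow_add hx]; congr 1; ring
    have h3 : Real.exp (-((1 + b) * x)) = Real.exp (-x) * Real.exp (-(b * x)) := by
      rw [← Real.exp_add]; congr 1; ring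
    rw [h2, h3]; ring

lemma isProbabilityMeasure_gammaLaw {α : ℝ} (hα : 0 < α) :
    IsProbabilityMeasure (gammaLaw α) := ⟨by
  have := lintegral_gammaLaw hα 0 0
  simpa [div_self (Real.Gamma_pos_of_pos hα).ne'] using this⟩

lemma gammaLaw_ae_pos (α : ℝ) : ∀ᵐ t ∂(gammaLaw α), t ≠ 0 := by
  change ∀ᵐ t ∂(gammaLaw α), t ∈ ({0} : Set ℝ≥0)ᶜ
  rw [gammaLaw, ae_map_iff (p := fun t => t ∈ ({0} : Set ℝ≥0)ᶜ) (by fun_prop)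
    (measurableSet_singleton (0 : ℝ≥0)).compl]
  refine (withDensity_absolutelyContinuous _ _).ae_le ?_
  filter_upwards [ae_restrict_mem measurableSet_Ioi] with x hx
  simpa using hx

/-- Frullani's integral `∫₀^∞ (1 - e^{-a x}) e^{-x} / x dx = log (1 + a)`. -/
lemma lintegral_frullani (a : ℝ≥0) :
    ∫⁻ x in Ioi (0 : ℝ), ENNReal.ofReal (Real.exp (-x) / x) * (1 - expNeg (a * ENNReal.ofReal x)) =
      ENNReal.ofReal (Real.log (1 + a)) := by
  -- Writes the integrand as `∫₀^a e^{-(1+u)x} du`, so that Tonelli's theorem leaves `∫₀^a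
  -- du/(1+u)`.
  have hinner : ∀ x ∈ Ioi (0 : ℝ), ENNReal.ofReal (Real.exp (-x) / x) *
      (1 - expNeg (a * ENNReal.ofReal x)) =
        ∫⁻ u in Ioc (0 : ℝ) a, ENNReal.ofReal (Real.exp (-((1 + u) * x))) := by
    intro x (hx : 0 < x)
    have h1 : (a : ℝ≥0∞) * ENNReal.ofReal x = ENNReal.ofReal (a * x) := by
      rw [ENNReal.ofReal_mul (by positivity), ENNReal.ofReal_coe_nnreal]
    rw [h1, expNeg_ofReal (by positivity), ← ENNReal.ofReal_one,
      ← ENNReal.ofReal_sub _ (Real.exp_nonneg _), ← ENNReal.ofReal_mul (by positivity),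
      ← ofReal_integral_eq_lintegral_ofReal
        ((Continuous.integrableOn_Icc (by fun_prop)).mono_set Ioc_subset_Icc_self)
        (ae_of_all _ fun u => (Real.exp_pos _).le),
      ← intervalIntegral.integral_of_le a.coe_nonneg]
    congr 1
    have hd : ∀ u ∈ uIcc (0 : ℝ) a, HasDerivAt (fun u : ℝ => -Real.exp (-((1 + u) * x)) / x)
        (Real.exp (-((1 + u) * x))) u := by
      intro u _
      have := (((((hasDerivAt_id u).const_add 1).mul_const x).neg).exp.neg).div_const x
      refine this.congr_deriv ?_
      simp
      field_simp
    rw [intervalIntegral.integral_eq_sub_of_hasDerivAt hd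
      (Continuous.intervalIntegrable (by fun_prop) _ _)]
    have h3 : Real.exp (-((1 + a) * x)) = Real.exp (-x) * Real.exp (-(a * x)) := by
      rw [← Real.exp_add]; congr 1; ring
    rw [h3]; simp only [add_zero, one_mul]; ring
  rw [setLIntegral_congr_fun measurableSet_Ioi hinner, lintegral_lintegral_swap (by fun_prop)]
  have houter : ∀ u ∈ Ioc (0 : ℝ) a,
      ∫⁻ x in Ioi (0 : ℝ), ENNReal.ofReal (Real.exp (-((1 + u) * x))) =
        ENNReal.ofReal (1 + u)⁻¹ := by
    intro u hu
    have := lintegral_rpow_mul_exp_neg (p := 1) (r := 1 + u) one_pos (by linarith [hu.1])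
    simpa using this
  rw [setLIntegral_congr_fun measurableSet_Ioc houter]
  have hc : ContinuousOn (fun u : ℝ => (1 + u)⁻¹) (Icc 0 a) := by
    refine ContinuousOn.inv₀ (by fun_prop) fun u hu => ?_
    have := hu.1
    positivity
  rw [← ofReal_integral_eq_lintegral_ofReal
    (hc.integrableOn_Icc.mono_set Ioc_subset_Icc_self), ← intervalIntegral.integral_of_le a.coe_nonneg]
  · congr 1
    have := intervalIntegral.integral_comp_add_left (a := 0) (b := a) (fun x : ℝ => x⁻¹) 1
    rw [this, integral_inv_of_pos (by norm_num) (by positivity)]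
    simp
  · filter_upwards [ae_restrict_mem measurableSet_Ioc] with u hu
    have := hu.1
    simp only [Pi.zero_apply]
    positivity

end GammaIntegrals

/-! ### Bucket masses and power sums of the jumps of the Gamma process. -/

section Masses

variable {S : Type*} [MeasurableSpace S] {J : ℕ}

/-- An integrand that sees the location only through its bucket sees `G₀` only through the bucket
masses, which are all `w`. -/
lemma lintegral_gammaIntensity (θ : ℝ) (G₀ : Measure S) [SFinite G₀] {h : S → Fin J}
    (hh : Measurable h) {w : ℝ≥0∞} (hG : ∀ j, G₀ (h ⁻¹' {j}) = w) {F : ℝ → Fin J → ℝ≥0∞}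
    (hF : Measurable (Function.uncurry F)) :
    ∫⁻ p, F p.1 (h p.2) ∂(gammaIntensity θ G₀) = ∑ j, ENNReal.ofReal θ * w *
      ∫⁻ x in Ioi (0 : ℝ), ENNReal.ofReal (Real.exp (-x) / x) * F x j := by
  have hF' : ∀ j, Measurable fun x => F x j := fun j => hF.comp (measurable_id.prodMk measurable_const)
  have hm : Measurable fun p : ℝ × S => F p.1 (h p.2) :=
    hF.comp (measurable_fst.prodMk (hh.comp measurable_snd))
  have hin : ∀ x, ∫⁻ s, F x (h s) ∂G₀ = ∑ j, F x j * w := by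
    intro x
    rw [← lintegral_map (f := F x) (by fun_prop) hh, lintegral_fintype]
    refine Finset.sum_congr rfl fun j _ => ?_
    rw [Measure.map_apply hh (measurableSet_singleton j), hG]
  rw [gammaIntensity, lintegral_smul_measure, lintegral_prod _ hm.aemeasurable]
  simp_rw [hin]
  have hm2 : Measurable fun x => ∑ j, F x j * w :=
    Finset.measurable_sum _ fun j _ => (hF' j).mul_const _
  rw [lintegral_withDensity_eq_lintegral_mul _ (by fun_prop) hm2, smul_eq_mul]
  simp_rw [Pi.mul_apply, Finset.mul_sum]
  rw [lintegral_finsetSum _ fun j _ => by have := hF' j; fun_prop, Finset.mul_sum]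
  refine Finset.sum_congr rfl fun j _ => ?_
  have hmj : Measurable fun x => ENNReal.ofReal (Real.exp (-x) / x) * F x j := by
    have := hF' j
    fun_prop
  rw [mul_assoc, ← lintegral_const_mul w hmj]
  congr 1
  refine lintegral_congr fun x => ?_
  ring

/-- The function `(x, s) ↦ x ^ r 1[h(s) = j]` on the space of points. -/
def jumpPower (h : S → Fin J) (j : Fin J) (r : ℕ) (p : ℝ × S) : ℝ≥0∞ :=
  if h p.2 = j then ENNReal.ofReal p.1 ^ r else 0

@[fun_prop] lemma measurable_jumpPower {h : S → Fin J} (hh : Measurable h) (j : Fin J) (r : ℕ) :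
    Measurable (jumpPower h j r) := by
  refine Measurable.ite ?_ (by fun_prop) measurable_const
  exact hh.comp measurable_snd (measurableSet_singleton j)

omit [MeasurableSpace S] in
lemma sum_mul_jumpPower (h : S → Fin J) (a : Fin J → ℝ≥0∞) (p : ℝ × S) :
    ∑ j, a j * jumpPower h j 1 p = a (h p.2) * ENNReal.ofReal p.1 := by
  simp [jumpPower]

variable {Ω : Type*} [MeasurableSpace Ω] {μ : Measure Ω} [IsProbabilityMeasure μ]
  {N : Ω → Measure (ℝ × S)} {θ α : ℝ} {G₀ : Measure S} [SFinite G₀] {h : S → Fin J} {w : ℝ≥0∞}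

/-- Frullani's integral in each bucket gives `exp(-α log(1 + a_j))`, the Laplace transform of a
Gamma law of shape `α`. -/
lemma lintegral_one_sub_expNeg_gammaIntensity (hh : Measurable h) (hG : ∀ j, G₀ (h ⁻¹' {j}) = w)
    (hw : ENNReal.ofReal θ * w = ENNReal.ofReal α) (hα : 0 < α) (a : Fin J → ℝ≥0) :
    expNeg (∫⁻ p, (1 - expNeg (∑ j, (a j : ℝ≥0∞) * jumpPower h j 1 p)) ∂(gammaIntensity θ G₀)) =
      ∏ j, ENNReal.ofReal (1 / (1 + a j) ^ α) := by
  simp_rw [sum_mul_jumpPower]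
  rw [lintegral_gammaIntensity θ G₀ hh hG
    (F := fun x j => 1 - expNeg ((a j : ℝ≥0∞) * ENNReal.ofReal x))]
  · simp_rw [lintegral_frullani, hw]
    rw [expNeg_sum]
    refine Finset.prod_congr rfl fun j _ => ?_
    have hl : 0 ≤ Real.log (1 + a j) := Real.log_nonneg (by simp)
    rw [← ENNReal.ofReal_mul hα.le, expNeg_ofReal (by positivity), Real.rpow_def_of_pos (by positivity),
      one_div, ← Real.exp_neg, mul_comm]
  · exact measurable_from_prod_countable_left fun j => by fun_prop

/-- The power `x^{r+1}` absorbs the singularity `1/x` of the Lévy density and leaves a Gamma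
integral with value `r! / (1 + a_j)^{r+1}`. -/
lemma lintegral_expNeg_mul_jumpPower (hh : Measurable h) (hG : ∀ j, G₀ (h ⁻¹' {j}) = w)
    (hw : ENNReal.ofReal θ * w = ENNReal.ofReal α) (hα : 0 < α) (a : Fin J → ℝ≥0) (j : Fin J)
    (r : ℕ) :
    ∫⁻ p, expNeg (∑ i, (a i : ℝ≥0∞) * jumpPower h i 1 p) * jumpPower h j (r + 1) p
        ∂(gammaIntensity θ G₀) =
      ENNReal.ofReal (α * r.factorial / (1 + a j) ^ (r + 1)) := by
  simp_rw [sum_mul_jumpPower, jumpPower]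
  rw [lintegral_gammaIntensity θ G₀ hh hG (F := fun x i => expNeg ((a i : ℝ≥0∞) * ENNReal.ofReal x) *
      if i = j then ENNReal.ofReal x ^ (r + 1) else 0)]
  · rw [Finset.sum_eq_single j]
    · rw [hw, setLIntegral_congr_fun (g := fun x => ENNReal.ofReal
        (x ^ (((r + 1 : ℕ) : ℝ) - 1) * Real.exp (-((1 + a j) * x)))) measurableSet_Ioi,
        lintegral_rpow_mul_exp_neg (by positivity) (by positivity),
        ← ENNReal.ofReal_mul hα.le, Real.rpow_natCast]
      · congr 1
        push_cast
        rw [Real.Gamma_nat_eq_factorial]; ring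
      · intro x (hx : 0 < x)
        have h1 : (a j : ℝ≥0∞) * ENNReal.ofReal x = ENNReal.ofReal (a j * x) := by
          rw [ENNReal.ofReal_mul (by positivity), ENNReal.ofReal_coe_nnreal]
        have h3 : Real.exp (-((1 + a j) * x)) = Real.exp (-x) * Real.exp (-(a j * x)) := by
          rw [← Real.exp_add]; congr 1; ring
        simp only [if_true]
        rw [h1, expNeg_ofReal (by positivity), ← ENNReal.ofReal_pow hx.le,
          ← ENNReal.ofReal_mul (by positivity), ← ENNReal.ofReal_mul (by positivity), h3]
        congr 1
        push_cast
        rw [add_sub_cancel_right, Real.rpow_natCast]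
        field_simp
        ring
    · intro i _ hi
      simp [hi]
    · simp
  · refine measurable_from_prod_countable_left fun i => ?_
    by_cases hi : i = j
    · simp only [hi, Function.uncurry_apply_pair, if_true]; fun_prop
    · simp [hi]

/-- The masses `μ̃(h⁻¹{j})` of the buckets. -/
def bucketMass (N : Ω → Measure (ℝ × S)) (h : S → Fin J) (ω : Ω) (j : Fin J) : ℝ≥0 :=
  (∫⁻ p, jumpPower h j 1 p ∂(N ω)).toNNReal

/-- The Mecke formula, read as the Laplace transform of the bucket masses under the law weighted by
a power sum of jumps. -/
lemma lintegral_jumpPower_eq (hN : IsPoissonRandomMeasure μ N (gammaIntensity θ G₀))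
    (hh : Measurable h) (hG : ∀ j, G₀ (h ⁻¹' {j}) = w)
    (hw : ENNReal.ofReal θ * w = ENNReal.ofReal α) (hα : 0 < α) (a : Fin J → ℝ≥0) (j : Fin J)
    (r : ℕ) :
    ∫⁻ ω, expNeg (∫⁻ p, ∑ i, (a i : ℝ≥0∞) * jumpPower h i 1 p ∂(N ω)) *
        ∫⁻ p, jumpPower h j (r + 1) p ∂(N ω) ∂μ =
      (∏ i, ENNReal.ofReal (1 / (1 + a i) ^ α)) *
        ENNReal.ofReal (α * r.factorial / (1 + a j) ^ (r + 1)) := by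
  rw [hN.lintegral_mul_expNeg (by fun_prop) (by fun_prop),
    lintegral_one_sub_expNeg_gammaIntensity hh hG hw hα,
    lintegral_expNeg_mul_jumpPower hh hG hw hα]

lemma lintegral_lintegral_jumpPower (hN : IsPoissonRandomMeasure μ N (gammaIntensity θ G₀))
    (hh : Measurable h) (hG : ∀ j, G₀ (h ⁻¹' {j}) = w)
    (hw : ENNReal.ofReal θ * w = ENNReal.ofReal α) (hα : 0 < α) (j : Fin J) (r : ℕ) :
    ∫⁻ ω, ∫⁻ p, jumpPower h j (r + 1) p ∂(N ω) ∂μ = ENNReal.ofReal (α * r.factorial) := by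
  simpa using lintegral_jumpPower_eq hN hh hG hw hα 0 j r

/-- `toNNReal` would turn an infinite mass into 0. This does not occur almost surely, because the
mean mass is `α`. -/
lemma ae_coe_bucketMass (hN : IsPoissonRandomMeasure μ N (gammaIntensity θ G₀))
    (hh : Measurable h) (hG : ∀ j, G₀ (h ⁻¹' {j}) = w)
    (hw : ENNReal.ofReal θ * w = ENNReal.ofReal α) (hα : 0 < α) :
    ∀ᵐ ω ∂μ, ∀ j, (bucketMass N h ω j : ℝ≥0∞) = ∫⁻ p, jumpPower h j 1 p ∂(N ω) := by
  rw [ae_all_iff]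
  intro j
  have h1 := lintegral_lintegral_jumpPower hN hh hG hw hα j 0
  filter_upwards [ae_lt_top (hN.measurable_lintegral (measurable_jumpPower hh j 1))
    (by rw [zero_add] at h1; rw [h1]; exact ENNReal.ofReal_ne_top)] with ω hω
  exact ENNReal.coe_toNNReal hω.ne

omit [IsProbabilityMeasure μ] [SFinite G₀] in
lemma measurable_bucketMass (hN : IsPoissonRandomMeasure μ N (gammaIntensity θ G₀))
    (hh : Measurable h) : Measurable (bucketMass N h) :=
  measurable_pi_lambda _ fun j =>
    (hN.measurable_lintegral (measurable_jumpPower hh j 1)).ennreal_toNNReal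

lemma lintegral_pi_prod {ι : Type*} [Fintype ι] {E : ι → Type*} [∀ i, MeasurableSpace (E i)]
    (ρ : ∀ i, Measure (E i)) [∀ i, IsProbabilityMeasure (ρ i)] {F : ∀ i, E i → ℝ≥0∞}
    (hF : ∀ i, Measurable (F i)) :
    ∫⁻ t, ∏ i, F i (t i) ∂(Measure.pi ρ) = ∏ i, ∫⁻ x, F i x ∂(ρ i) := by
  refine (lintegral_prod_eq_prod_lintegral_of_indepFun Finset.univ
    (fun i (t : ∀ i, E i) => F i (t i)) (iIndepFun_pi fun i => (hF i).aemeasurable)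
    fun i => (hF i).comp (measurable_pi_apply i)).trans ?_
  refine Finset.prod_congr rfl fun i _ => ?_
  rw [← lintegral_map (hF i) (measurable_pi_apply i), (measurePreserving_eval ρ i).map_eq]

/-- The bucket masses are independent with Gamma laws. -/
lemma map_bucketMass (hN : IsPoissonRandomMeasure μ N (gammaIntensity θ G₀))
    (hh : Measurable h) (hG : ∀ j, G₀ (h ⁻¹' {j}) = w)
    (hw : ENNReal.ofReal θ * w = ENNReal.ofReal α) (hα : 0 < α) :
    μ.map (bucketMass N h) = Measure.pi fun _ => gammaLaw α := by
  have := isProbabilityMeasure_gammaLaw hα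
  have hT := measurable_bucketMass hN hh
  have : IsProbabilityMeasure (μ.map (bucketMass N h)) :=
    Measure.isProbabilityMeasure_map hT.aemeasurable
  refine ext_of_lintegral_expNeg fun a => ?_
  rw [lintegral_map (by fun_prop) hT]
  have h1 : ∫⁻ ω, expNeg (∑ i, (a i : ℝ≥0∞) * bucketMass N h ω i) ∂μ =
      ∫⁻ ω, expNeg (∫⁻ p, ∑ i, (a i : ℝ≥0∞) * jumpPower h i 1 p ∂(N ω)) ∂μ := by
    refine lintegral_congr_ae ?_
    filter_upwards [ae_coe_bucketMass hN hh hG hw hα] with ω hω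
    rw [lintegral_finsetSum _ fun i _ => by fun_prop]
    simp_rw [hω]
    congr 1
    exact Finset.sum_congr rfl fun i _ => (lintegral_const_mul _ (by fun_prop)).symm
  rw [h1, hN.lintegral_expNeg (by fun_prop), lintegral_one_sub_expNeg_gammaIntensity hh hG hw hα]
  simp_rw [expNeg_sum]
  rw [lintegral_pi_prod (fun _ => gammaLaw α) (F := fun i x => expNeg ((a i : ℝ≥0∞) * x))
    fun i => by fun_prop]
  refine Finset.prod_congr rfl fun i _ => ?_
  have := lintegral_gammaLaw hα 0 (a i)
  simp only [pow_zero, one_mul, CharP.cast_eq_zero, add_zero] at this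
  rw [this, div_self (Real.Gamma_pos_of_pos hα).ne']

lemma ae_bucketMass_ne_zero (hN : IsPoissonRandomMeasure μ N (gammaIntensity θ G₀))
    (hh : Measurable h) (hG : ∀ j, G₀ (h ⁻¹' {j}) = w)
    (hw : ENNReal.ofReal θ * w = ENNReal.ofReal α) (hα : 0 < α) :
    ∀ᵐ ω ∂μ, ∀ j, bucketMass N h ω j ≠ 0 := by
  have := isProbabilityMeasure_gammaLaw hα
  have h1 : ∀ᵐ t ∂(μ.map (bucketMass N h)), ∀ j, t j ≠ 0 := by
    rw [map_bucketMass hN hh hG hw hα, ae_all_iff]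
    intro j
    exact (measurePreserving_eval (fun _ : Fin J => gammaLaw α) j).quasiMeasurePreserving.ae
      (gammaLaw_ae_pos α)
  exact ae_of_ae_map (measurable_bucketMass hN hh).aemeasurable h1

/-- The moment `E[∑ p_k ^ (r + 1)]` of the weights `p_k` of a Dirichlet process with total mass
`α`. -/
def weightMoment (α : ℝ) (r : ℕ) : ℝ :=
  α * r.factorial * Real.Gamma α / Real.Gamma (α + r + 1)

lemma weightMoment_nonneg {α : ℝ} (hα : 0 < α) (r : ℕ) : 0 ≤ weightMoment α r := by
  have := Real.Gamma_pos_of_pos hα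
  have := Real.Gamma_pos_of_pos (show 0 < α + r + 1 by positivity)
  unfold weightMoment
  positivity

/-- The density form of `E[R | T] = w_r T_j^{r+1}`, with `R` the power sum in bucket `j`, `T` the
bucket masses and `w_r = weightMoment α r`. Both measures have the same Laplace transform; `w_r` is
the constant that matches `α r!` with the Gamma moment `Γ(α+r+1)/Γ(α)`. -/
lemma map_withDensity_bucketMass (hN : IsPoissonRandomMeasure μ N (gammaIntensity θ G₀))
    (hh : Measurable h) (hG : ∀ j, G₀ (h ⁻¹' {j}) = w)
    (hw : ENNReal.ofReal θ * w = ENNReal.ofReal α) (hα : 0 < α) (j : Fin J) (r : ℕ) :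
    (μ.withDensity fun ω => ∫⁻ p, jumpPower h j (r + 1) p ∂(N ω)).map (bucketMass N h) =
      (μ.map (bucketMass N h)).withDensity
        fun t => ENNReal.ofReal (weightMoment α r) * (t j : ℝ≥0∞) ^ (r + 1) := by
  have hP := isProbabilityMeasure_gammaLaw hα
  have hT := measurable_bucketMass hN hh
  have hmR : Measurable fun ω => ∫⁻ p, jumpPower h j (r + 1) p ∂(N ω) :=
    hN.measurable_lintegral (measurable_jumpPower hh j (r + 1))
  rw [map_bucketMass hN hh hG hw hα]
  have hb : ∀ a : Fin J → ℝ≥0, ∫⁻ t, expNeg (∑ i, (a i : ℝ≥0∞) * t i)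
      ∂((Measure.pi fun _ => gammaLaw α).withDensity
        fun t => ENNReal.ofReal (weightMoment α r) * (t j : ℝ≥0∞) ^ (r + 1)) =
      (∏ i, ENNReal.ofReal (1 / (1 + a i) ^ α)) *
        ENNReal.ofReal (α * r.factorial / (1 + a j) ^ (r + 1)) := by
    intro a
    rw [lintegral_withDensity_eq_lintegral_mul _ (by fun_prop) (by fun_prop)]
    simp only [Pi.mul_apply, mul_assoc]
    rw [lintegral_const_mul _ (by fun_prop)]
    have hprod : ∀ t : Fin J → ℝ≥0, (t j : ℝ≥0∞) ^ (r + 1) *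
        expNeg (∑ i, (a i : ℝ≥0∞) * t i) =
        ∏ i, (t i : ℝ≥0∞) ^ (if i = j then r + 1 else 0) * expNeg (a i * t i) := by
      intro t
      rw [Finset.prod_mul_distrib, expNeg_sum]
      congr 1
      rw [Finset.prod_eq_single j]
      · simp
      · intro i _ hi; simp [hi]
      · simp
    simp_rw [hprod]
    rw [lintegral_pi_prod (fun _ => gammaLaw α)
      (F := fun i x => (x : ℝ≥0∞) ^ (if i = j then r + 1 else 0) * expNeg ((a i : ℝ≥0∞) * x))
      fun i => by fun_prop]
    simp_rw [lintegral_gammaLaw hα]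
    have hΓ := Real.Gamma_pos_of_pos hα
    have hΓ' := Real.Gamma_pos_of_pos (show 0 < α + r + 1 by positivity)
    rw [← Finset.mul_prod_erase _ _ (Finset.mem_univ j),
      ← Finset.mul_prod_erase _ (fun i => ENNReal.ofReal (1 / (1 + a i) ^ α)) (Finset.mem_univ j)]
    have he : ∏ i ∈ Finset.univ.erase j, ENNReal.ofReal
        (Real.Gamma (α + (if i = j then r + 1 else 0 : ℕ)) / Real.Gamma α /
          (1 + a i) ^ (α + (if i = j then r + 1 else 0 : ℕ))) =
        ∏ i ∈ Finset.univ.erase j, ENNReal.ofReal (1 / (1 + a i) ^ α) := by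
      refine Finset.prod_congr rfl fun i hi => ?_
      rw [if_neg (Finset.ne_of_mem_erase hi)]
      simp [div_self hΓ.ne']
    rw [he, if_pos rfl, ← mul_assoc, ← ENNReal.ofReal_mul (weightMoment_nonneg hα r)]
    conv_rhs => rw [mul_right_comm, ← ENNReal.ofReal_mul (by positivity)]
    congr 2
    have hr : (1 + a j : ℝ) ^ (α + ((r + 1 : ℕ) : ℝ)) = (1 + a j : ℝ) ^ α * (1 + a j) ^ (r + 1) := by
      rw [Real.rpow_add (by positivity), Real.rpow_natCast]
    rw [hr, weightMoment]
    push_cast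
    rw [← add_assoc]
    field_simp
  -- Laplace uniqueness requires finite measures; the total masses are the transforms at `a = 0`.
  have hfin1 : IsFiniteMeasure (μ.withDensity fun ω => ∫⁻ p, jumpPower h j (r + 1) p ∂(N ω)) :=
    isFiniteMeasure_withDensity (by
      rw [lintegral_lintegral_jumpPower hN hh hG hw hα]; exact ENNReal.ofReal_ne_top)
  have hfin2 : IsFiniteMeasure ((Measure.pi fun _ : Fin J => gammaLaw α).withDensity
        fun t => ENNReal.ofReal (weightMoment α r) * (t j : ℝ≥0∞) ^ (r + 1)) := by
    refine ⟨?_⟩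
    have := hb 0
    simp only [Pi.zero_apply, ENNReal.coe_zero, zero_mul, Finset.sum_const_zero, expNeg_zero,
      lintegral_const, one_mul] at this
    rw [this]
    exact ENNReal.mul_lt_top (ENNReal.prod_lt_top fun _ _ => ENNReal.ofReal_lt_top)
      ENNReal.ofReal_lt_top
  refine ext_of_lintegral_expNeg fun a => ?_
  rw [hb a, lintegral_map (by fun_prop) hT,
    lintegral_withDensity_eq_lintegral_mul _ hmR (by fun_prop),
    ← lintegral_jumpPower_eq hN hh hG hw hα]
  refine lintegral_congr_ae ?_
  filter_upwards [ae_coe_bucketMass hN hh hG hw hα] with ω hω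
  rw [Pi.mul_apply, mul_comm, lintegral_finsetSum _ fun i _ => by fun_prop]
  simp_rw [hω]
  congr 2
  exact Finset.sum_congr rfl fun i _ => (lintegral_const_mul _ (by fun_prop)).symm

/-- The normalized power sums of the jumps in a bucket have mean `weightMoment α r`, conditionally
on the masses of the buckets. -/
lemma lintegral_jumpPower_div_mul (hN : IsPoissonRandomMeasure μ N (gammaIntensity θ G₀))
    (hh : Measurable h) (hG : ∀ j, G₀ (h ⁻¹' {j}) = w)
    (hw : ENNReal.ofReal θ * w = ENNReal.ofReal α) (hα : 0 < α) (j : Fin J) (r : ℕ)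
    {φ : (Fin J → ℝ≥0) → ℝ≥0∞} (hφ : Measurable φ) :
    ∫⁻ ω, (∫⁻ p, jumpPower h j (r + 1) p ∂(N ω)) / (bucketMass N h ω j : ℝ≥0∞) ^ (r + 1) *
        φ (bucketMass N h ω) ∂μ =
      ENNReal.ofReal (weightMoment α r) * ∫⁻ ω, φ (bucketMass N h ω) ∂μ := by
  have hT := measurable_bucketMass hN hh
  have hmR : Measurable fun ω => ∫⁻ p, jumpPower h j (r + 1) p ∂(N ω) :=
    hN.measurable_lintegral (measurable_jumpPower hh j (r + 1))
  -- The denominator `T_j^{r+1}` is moved into the test function; the density of the weighted law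
  -- then cancels it, since `T_j > 0` almost surely.
  have hmψ : Measurable fun t : Fin J → ℝ≥0 => ((t j : ℝ≥0∞) ^ (r + 1))⁻¹ * φ t := by fun_prop
  have h1 : ∫⁻ ω, (∫⁻ p, jumpPower h j (r + 1) p ∂(N ω)) /
      (bucketMass N h ω j : ℝ≥0∞) ^ (r + 1) * φ (bucketMass N h ω) ∂μ =
      ∫⁻ t, ((t j : ℝ≥0∞) ^ (r + 1))⁻¹ * φ t
      ∂((μ.withDensity fun ω => ∫⁻ p, jumpPower h j (r + 1) p ∂(N ω)).map (bucketMass N h)) := by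
    rw [lintegral_map hmψ hT,
      lintegral_withDensity_eq_lintegral_mul _ hmR
        (show Measurable fun ω => ((bucketMass N h ω j : ℝ≥0∞) ^ (r + 1))⁻¹ * φ (bucketMass N h ω)
          from hmψ.comp hT)]
    refine lintegral_congr fun ω => ?_
    simp only [Pi.mul_apply]
    rw [div_eq_mul_inv, mul_assoc]
  rw [h1, map_withDensity_bucketMass hN hh hG hw hα,
    lintegral_withDensity_eq_lintegral_mul _ (by fun_prop) hmψ, lintegral_map (by fun_prop) hT,
    ← lintegral_const_mul _ (show Measurable fun ω => φ (bucketMass N h ω) from hφ.comp hT)]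
  refine lintegral_congr_ae ?_
  filter_upwards [ae_bucketMass_ne_zero hN hh hG hw hα] with ω hω
  simp only [Pi.mul_apply]
  rw [mul_assoc, ← mul_assoc (_ ^ (r + 1)), ENNReal.mul_inv_cancel, one_mul]
  · exact pow_ne_zero _ (by simpa using hω j)
  · exact ENNReal.pow_ne_top ENNReal.coe_ne_top

end Masses

/-! ### Almost sure distinctness of the atom locations. -/

section DistinctLocations

variable {Ω E : Type*} [MeasurableSpace Ω] [MeasurableSpace E] {μ : Measure Ω}
  [IsProbabilityMeasure μ] {N : Ω → Measure E} {ν : Measure E}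

/-- With `e^{-r} ≥ 1 - r`, the probability of two or more points satisfies `1 - e^{-r}(1 + r) ≤ 1 -
(1 - r)(1 + r) = r²`. -/
lemma IsPoissonRandomMeasure.measure_two_le (hN : IsPoissonRandomMeasure μ N ν) {A : Set E}
    (hA : MeasurableSet A) (hν : ν A ≠ ∞) :
    μ {ω | N ω A ≠ 0 ∧ N ω A ≠ 1} ≤ ν A * ν A := by
  have h0 := hN.count_law A hA hν 0
  have h1 := hN.count_law A hA hν 1
  set r := (ν A).toNNReal with hr
  have hm0 : MeasurableSet {ω | N ω A = ((0 : ℕ) : ℝ≥0∞)} :=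
    hN.measurable_apply hA (measurableSet_singleton _)
  have hm1 : MeasurableSet {ω | N ω A = ((1 : ℕ) : ℝ≥0∞)} :=
    hN.measurable_apply hA (measurableSet_singleton _)
  have hset : {ω | N ω A ≠ 0 ∧ N ω A ≠ 1} =
      ({ω | N ω A = ((0 : ℕ) : ℝ≥0∞)} ∪ {ω | N ω A = ((1 : ℕ) : ℝ≥0∞)})ᶜ := by
    ext ω; simp
  rw [hset, prob_compl_eq_one_sub (hm0.union hm1), measure_union _ hm1, h0, h1,
    poissonMeasure_singleton, poissonMeasure_singleton,
    ← ENNReal.ofReal_add (by positivity) (by positivity), ← ENNReal.ofReal_one,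
    ← ENNReal.ofReal_sub _ (by positivity), ← ENNReal.coe_toNNReal hν, ← hr, ← ENNReal.coe_mul,
    ← ENNReal.ofReal_coe_nnreal]
  · refine ENNReal.ofReal_le_ofReal ?_
    have he := Real.add_one_le_exp (-(r : ℝ))
    have hr0 : (0 : ℝ) ≤ r := r.coe_nonneg
    simp only [pow_zero, mul_one, Nat.factorial, Nat.cast_one, div_one, pow_one]
    push_cast
    nlinarith
  · refine Set.disjoint_left.2 fun ω ha hb => ?_
    simp only [mem_ofPred_eq] at ha hb
    simp [ha] at hb

end DistinctLocations

section Gamma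

variable {S : Type*} [MeasurableSpace S]

/-- Jumps above `ε` have finite intensity because `e^{-x}/x ≤ e^{-x}/ε` there. -/
lemma exists_gammaIntensity_Ioi_prod (θ : ℝ) (G₀ : Measure S) [SFinite G₀] {ε : ℝ} (hε : 0 < ε) :
    ∃ K : ℝ≥0∞, K ≠ ∞ ∧ ∀ A : Set S, gammaIntensity θ G₀ (Ioi ε ×ˢ A) = K * G₀ A := by
  refine ⟨ENNReal.ofReal θ * ((volume.restrict (Ioi (0 : ℝ))).withDensity
    (fun x => ENNReal.ofReal (Real.exp (-x) / x))) (Ioi ε), ?_, fun A => ?_⟩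
  · refine ENNReal.mul_ne_top ENNReal.ofReal_ne_top ?_
    rw [withDensity_apply _ measurableSet_Ioi, Measure.restrict_restrict measurableSet_Ioi,
      inter_eq_self_of_subset_left (Ioi_subset_Ioi hε.le)]
    refine ne_top_of_le_ne_top (b := ENNReal.ofReal ε⁻¹ *
      ∫⁻ x in Ioi 0, ENNReal.ofReal (x ^ ((1 : ℝ) - 1) * Real.exp (-(1 * x)))) ?_ ?_
    · rw [lintegral_rpow_mul_exp_neg one_pos one_pos]
      exact ENNReal.mul_ne_top ENNReal.ofReal_ne_top ENNReal.ofReal_ne_top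
    · rw [← lintegral_const_mul _ (by fun_prop)]
      refine (setLIntegral_mono (by fun_prop) fun x (hx : ε < x) => ?_).trans
        (lintegral_mono_set (Ioi_subset_Ioi hε.le))
      rw [← ENNReal.ofReal_mul (by positivity)]
      refine ENNReal.ofReal_le_ofReal ?_
      rw [sub_self, Real.rpow_zero, one_mul, one_mul, div_eq_inv_mul]
      gcongr
  · rw [gammaIntensity, Measure.smul_apply, Measure.prod_prod, smul_eq_mul, mul_assoc]

/-- The sum is the probability that two independent points share their first `m` binary digits. The
digit map is injective, so these events decrease to the diagonal, which is null because `G₀` has no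
atoms. -/
lemma tendsto_sum_sq_measure_cells [StandardBorelSpace S] (G₀ : Measure S) [IsFiniteMeasure G₀]
    [NullSingletonClass G₀] :
    Tendsto (fun m : ℕ => ∑ v : Fin m → Bool,
      G₀ {s | (fun i : Fin m => MeasurableSpace.mapNatBool S s i) = v} *
        G₀ {s | (fun i : Fin m => MeasurableSpace.mapNatBool S s i) = v}) atTop (𝓝 0) := by
  have hπ : ∀ m, Measurable fun (s : S) (i : Fin m) => MeasurableSpace.mapNatBool S s i := fun m =>
    measurable_pi_lambda _ fun i => (measurable_pi_apply (i : ℕ)).comp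
      (MeasurableSpace.measurable_mapNatBool S)
  let D : ℕ → Set (S × S) := fun m =>
    {z | (fun i : Fin m => MeasurableSpace.mapNatBool S z.1 i) =
      fun i : Fin m => MeasurableSpace.mapNatBool S z.2 i}
  have hD : ∀ m, MeasurableSet (D m) := fun m =>
    measurableSet_eq_fun ((hπ m).comp measurable_fst) ((hπ m).comp measurable_snd)
  have hsum : ∀ m : ℕ, ∑ v : Fin m → Bool,
      G₀ {s | (fun i : Fin m => MeasurableSpace.mapNatBool S s i) = v} *
        G₀ {s | (fun i : Fin m => MeasurableSpace.mapNatBool S s i) = v} = (G₀.prod G₀) (D m) := by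
    intro m
    rw [Measure.prod_apply (hD m)]
    have := lintegral_map (μ := G₀) (f := fun v : Fin m → Bool =>
      G₀ {s | (fun i : Fin m => MeasurableSpace.mapNatBool S s i) = v}) (measurable_of_finite _) (hπ m)
    rw [lintegral_fintype] at this
    simp_rw [Measure.map_apply (hπ m) (measurableSet_singleton _)] at this
    refine this.trans (lintegral_congr fun s => ?_)
    congr 1
    ext t
    exact eq_comm
  have hanti : Antitone D := by
    intro m m' hmm z hz
    ext i
    exact congrFun hz (Fin.castLE hmm i)
  have hinter : (G₀.prod G₀) (⋂ m, D m) = 0 := by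
    have hsub : (⋂ m, D m) ⊆ {y : S × S | y.1 = y.2} := by
      intro z hz
      refine MeasurableSpace.injective_mapNatBool S (funext fun i => ?_)
      have h1 : z ∈ D (i + 1) := mem_iInter.1 hz (i + 1)
      exact congrFun h1 (Fin.last i)
    refine measure_mono_null hsub ?_
    rw [Measure.prod_apply (measurableSet_eq_fun measurable_fst measurable_snd)]
    simp
  simp_rw [hsum]
  rw [← hinter]
  exact tendsto_measure_iInter_atTop (fun m => (hD m).nullMeasurableSet) hanti
    ⟨0, measure_ne_top _ _⟩

variable {Ω : Type*} [MeasurableSpace Ω] {μ : Measure Ω} [IsProbabilityMeasure μ]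

lemma two_le_pointMeasure {p : ℕ → ℝ × S} {A : Set (ℝ × S)} (hA : MeasurableSet A) {k l : ℕ}
    (hkl : k ≠ l) (hk : p k ∈ A) (hl : p l ∈ A) : 2 ≤ pointMeasure p A := by
  rw [pointMeasure, Measure.sum_apply _ hA]
  refine le_trans ?_ (ENNReal.sum_le_tsum {k, l})
  rw [Finset.sum_pair hkl, Measure.dirac_apply_of_mem hk, Measure.dirac_apply_of_mem hl]
  norm_num

/-- The locations of the points with positive jumps are almost surely distinct. -/
lemma ae_locations_ne [StandardBorelSpace S] {p : ℕ → Ω → ℝ × S} {θ : ℝ} {G₀ : Measure S}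
    [IsFiniteMeasure G₀] [NullSingletonClass G₀]
    (hN : IsPoissonRandomMeasure μ (fun ω => pointMeasure fun k => p k ω) (gammaIntensity θ G₀)) :
    ∀ᵐ ω ∂μ, ∀ k l, k ≠ l → 0 < (p k ω).1 → 0 < (p l ω).1 → (p k ω).2 ≠ (p l ω).2 := by
  have hmain : ∀ ε : ℝ, 0 < ε → ∀ᵐ ω ∂μ, ∀ k l, k ≠ l → ε < (p k ω).1 → ε < (p l ω).1 →
      (p k ω).2 ≠ (p l ω).2 := by
    intro ε hε
    obtain ⟨K, hK, hν⟩ := exists_gammaIntensity_Ioi_prod θ G₀ hε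
    let A : (m : ℕ) → (Fin m → Bool) → Set S := fun m v =>
      {s | (fun i : Fin m => MeasurableSpace.mapNatBool S s i) = v}
    have hA : ∀ m v, MeasurableSet (A m v) := fun m v =>
      (measurable_pi_lambda _ fun i : Fin m => (measurable_pi_apply (i : ℕ)).comp
        (MeasurableSpace.measurable_mapNatBool S)) (measurableSet_singleton v)
    rw [ae_iff]
    refine le_antisymm ?_ (zero_le)
    have hlim : Tendsto (fun m : ℕ => K * K * ∑ v, G₀ (A m v) * G₀ (A m v)) atTop (𝓝 0) := by
      have := ENNReal.Tendsto.const_mul (a := K * K) (tendsto_sum_sq_measure_cells G₀)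
        (Or.inr (ENNReal.mul_ne_top hK hK))
      rwa [mul_zero] at this
    -- Two jumps above `ε` at one location put two points in the same cell at every level `m`. The
    -- union bound over cells is at most `K²` times the sum of squared cell masses, which tends to
    -- 0.
    refine ge_of_tendsto' hlim fun m => ?_
    calc _ ≤ μ (⋃ v, {ω | pointMeasure (fun k => p k ω) (Ioi ε ×ˢ A m v) ≠ 0 ∧
          pointMeasure (fun k => p k ω) (Ioi ε ×ˢ A m v) ≠ 1}) := by
          refine measure_mono fun ω hω => ?_
          simp only [ne_eq, mem_ofPred_eq, not_forall, not_not] at hω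
          obtain ⟨k, l, hkl, hk, hl, hs⟩ := hω
          refine mem_iUnion.2 ⟨fun i => MeasurableSpace.mapNatBool S (p k ω).2 i, ?_⟩
          have h2 := two_le_pointMeasure (p := fun k => p k ω)
            (measurableSet_Ioi.prod (hA m fun i => MeasurableSpace.mapNatBool S (p k ω).2 i)) hkl
            ⟨hk, rfl⟩ ⟨hl, by
              change (fun i : Fin m => MeasurableSpace.mapNatBool S (p l ω).2 i) = _
              rw [hs]⟩
          constructor
          · intro h0; rw [h0] at h2; simp at h2
          · intro h1; rw [h1] at h2; norm_num at h2
      _ ≤ ∑ v, μ {ω | pointMeasure (fun k => p k ω) (Ioi ε ×ˢ A m v) ≠ 0 ∧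
          pointMeasure (fun k => p k ω) (Ioi ε ×ˢ A m v) ≠ 1} := measure_iUnion_fintype_le _ _
      _ ≤ ∑ v, (K * G₀ (A m v)) * (K * G₀ (A m v)) := by
          refine Finset.sum_le_sum fun v _ => ?_
          rw [← hν]
          refine hN.measure_two_le (measurableSet_Ioi.prod (hA m v)) ?_
          rw [hν]
          exact ENNReal.mul_ne_top hK (measure_ne_top _ _)
      _ = K * K * ∑ v, G₀ (A m v) * G₀ (A m v) := by
          rw [Finset.mul_sum]
          exact Finset.sum_congr rfl fun v _ => by ring
  have hall := ae_all_iff.2 fun m : ℕ => hmain (1 / (m + 1 : ℝ)) (by positivity)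
  filter_upwards [hall] with ω hω k l hkl hk hl
  obtain ⟨m, hm⟩ := exists_nat_one_div_lt (lt_min hk hl)
  exact hω m k l hkl (hm.trans_le (min_le_left _ _)) (hm.trans_le (min_le_right _ _))

end Gamma

/-! ### Atom moments of the jump measure and their scaling. -/

section JumpMeasure

variable {S : Type*} [MeasurableSpace S] [MeasurableSingletonClass S] {J : ℕ}

/-- The integral `∫_{h(s) = j} P{s} ^ r P(ds)`. -/
def atomMoment (h : S → Fin J) (j : Fin J) (r : ℕ) (P : Measure S) : ℝ≥0∞ :=
  ∫⁻ s in h ⁻¹' {j}, P {s} ^ r ∂P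

lemma lintegral_jumpMeasure (p : ℕ → ℝ × S) (f : S → ℝ≥0∞) :
    ∫⁻ s, f s ∂(jumpMeasure p) = ∑' k, ENNReal.ofReal (p k).1 * f (p k).2 := by
  simp [jumpMeasure, lintegral_sum_measure, lintegral_smul_measure]

lemma lintegral_pointMeasure (p : ℕ → ℝ × S) (f : ℝ × S → ℝ≥0∞) :
    ∫⁻ x, f x ∂(pointMeasure p) = ∑' k, f (p k) := by
  simp [pointMeasure, lintegral_sum_measure]

/-- With distinct locations the atom at `S_k` has mass exactly `J_k`; integrating against the
measure supplies the extra power. Non-positive jumps carry no mass through `ENNReal.ofReal`. -/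
lemma atomMoment_jumpMeasure {p : ℕ → ℝ × S}
    (hp : ∀ k l, k ≠ l → 0 < (p k).1 → 0 < (p l).1 → (p k).2 ≠ (p l).2)
    {h : S → Fin J} (hh : Measurable h) (j : Fin J) (r : ℕ) :
    atomMoment h j r (jumpMeasure p) = ∫⁻ x, jumpPower h j (r + 1) x ∂(pointMeasure p) := by
  rw [atomMoment, ← lintegral_indicator (hh (measurableSet_singleton j)), lintegral_jumpMeasure,
    lintegral_pointMeasure]
  refine tsum_congr fun k => ?_
  by_cases hj : h (p k).2 = j
  · rw [indicator_of_mem (show (p k).2 ∈ h ⁻¹' {j} from hj), jumpPower, if_pos hj, pow_succ']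
    rcases le_or_gt (p k).1 0 with hk | hk
    · simp [ENNReal.ofReal_of_nonpos hk]
    · congr 2
      rw [← lintegral_indicator_one (measurableSet_singleton _), lintegral_jumpMeasure,
        tsum_eq_single k]
      · simp
      · intro l hl
        rcases le_or_gt (p l).1 0 with hl0 | hl0
        · simp [ENNReal.ofReal_of_nonpos hl0]
        · simp [hp l k hl hl0 hk]
  · rw [indicator_of_notMem (show (p k).2 ∉ h ⁻¹' {j} from hj), jumpPower, if_neg hj, mul_zero]

lemma jumpMeasure_preimage (p : ℕ → ℝ × S) {h : S → Fin J} (hh : Measurable h) (j : Fin J) :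
    jumpMeasure p (h ⁻¹' {j}) = ∫⁻ x, jumpPower h j 1 x ∂(pointMeasure p) := by
  rw [← lintegral_indicator_one (hh (measurableSet_singleton j)), lintegral_jumpMeasure,
    lintegral_pointMeasure]
  refine tsum_congr fun k => ?_
  by_cases hj : h (p k).2 = j <;> simp [jumpPower, hj]

omit [MeasurableSingletonClass S] in
lemma measure_univ_eq_sum_preimage {h : S → Fin J} (hh : Measurable h) (P : Measure S) :
    P univ = ∑ j, P (h ⁻¹' {j}) := by
  have := lintegral_map (μ := P) (f := fun _ : Fin J => 1) measurable_const hh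
  rw [lintegral_fintype] at this
  simp only [one_mul, lintegral_const] at this
  rw [← this]
  exact Finset.sum_congr rfl fun j _ => Measure.map_apply hh (measurableSet_singleton j)

omit [MeasurableSingletonClass S] in
lemma atomMoment_smul (h : S → Fin J) (j : Fin J) (r : ℕ) (P : Measure S) {a : ℝ≥0∞}
    (ha : a ≠ ∞) : atomMoment h j r (a • P) = a ^ (r + 1) * atomMoment h j r P := by
  simp only [atomMoment, Measure.smul_apply, smul_eq_mul, mul_pow, Measure.restrict_smul,
    lintegral_smul_measure]
  rw [lintegral_const_mul' _ _ (ENNReal.pow_ne_top ha), ← mul_assoc, pow_succ']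

-- Scale invariance is what allows the Dirichlet process to be replaced by the unnormalized Gamma
-- process.
omit [MeasurableSingletonClass S] in
lemma atomMoment_smul_div (h : S → Fin J) (j : Fin J) (r : ℕ) (P : Measure S) {a : ℝ≥0∞}
    (ha0 : a ≠ 0) (ha : a ≠ ∞) :
    atomMoment h j r (a • P) / (a • P) (h ⁻¹' {j}) ^ (r + 1) =
      atomMoment h j r P / P (h ⁻¹' {j}) ^ (r + 1) := by
  rw [atomMoment_smul h j r P ha, Measure.smul_apply, smul_eq_mul, mul_pow]
  exact ENNReal.mul_div_mul_left _ _ (pow_ne_zero _ ha0) (ENNReal.pow_ne_top ha)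

end JumpMeasure

/-! ### Sampling from a fixed `P`: the law of the query frequency given the sketch. -/

section Sampling

variable {S : Type*} {J n : ℕ}

open Classical in
/-- The bucket assignments of `n` symbols that produce the sketch `c`. -/
def sketchAssignments (n : ℕ) (c : Fin J → ℕ) : Finset (Fin n → Fin J) :=
  Finset.univ.filter fun a => ∀ j, (Finset.univ.filter fun i => a i = j).card = c j

/-- Needed only for non-degenerate conditioning: the number of assignments cancels, provided that it
is nonzero. -/
lemma sketchAssignments_nonempty {c : Fin J → ℕ} (hc : ∑ j, c j = n) :
    (sketchAssignments n c).Nonempty := by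
  classical
  have e : Fin n ≃ Σ j : Fin J, Fin (c j) := Fintype.equivOfCardEq (by simp [hc])
  refine ⟨fun i => (e i).1, ?_⟩
  simp only [sketchAssignments, Finset.mem_filter, Finset.mem_univ, true_and]
  intro j
  have h1 : (Finset.univ.filter fun i => (e i).1 = j).card =
      (Finset.univ.filter fun x : Σ j : Fin J, Fin (c j) => x.1 = j).card := by
    rw [← Finset.card_map e.toEmbedding]
    congr 1
    ext x
    simp only [Finset.mem_map, Finset.mem_filter, Finset.mem_univ, true_and,
      Equiv.coe_toEmbedding]
    exact ⟨fun ⟨i, hi, hx⟩ => hx ▸ hi, fun hx => ⟨e.symm x, by simpa using hx, by simp⟩⟩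
  rw [h1]
  have h2 : (Finset.univ.filter fun x : Σ j : Fin J, Fin (c j) => x.1 = j) =
      (Finset.univ : Finset (Fin (c j))).map ⟨Sigma.mk j, sigma_mk_injective⟩ := by
    ext ⟨k, x⟩
    simp only [Finset.mem_filter, Finset.mem_univ, true_and, Finset.mem_map,
      Function.Embedding.coeFn_mk]
    constructor
    · rintro rfl; exact ⟨x, rfl⟩
    · rintro ⟨y, hy⟩; exact (congrArg Sigma.fst hy).symm
  rw [h2, Finset.card_map, Finset.card_fin]

open Classical in
/-- The weight `u ^ f`, with `f` the frequency of `s` among `y`, on the event that the symbols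
`y` are in the buckets `a`. -/
def assignmentWeight (h : S → Fin J) (u : ℝ) (a : Fin n → Fin J) (s : S) (y : Fin n → S) : ℝ :=
  ∏ i, if h (y i) = a i then (if y i = s then u else 1) else 0

-- Only the actual bucket assignment of the sample has nonzero weight, and it is in the sum exactly
-- when the sketch is `c`.
open Classical in
lemma sum_assignmentWeight (h : S → Fin J) (u : ℝ) (c : Fin J → ℕ) (x : Fin (n + 1) → S) :
    ∑ a ∈ sketchAssignments n c,
        assignmentWeight h u a (x (Fin.last n)) (fun i => x i.castSucc) =
      if sketch h x = c then u ^ queryFrequency x else 0 := by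
  have hw : ∀ a : Fin n → Fin J, assignmentWeight h u a (x (Fin.last n)) (fun i => x i.castSucc) =
      if (fun i : Fin n => h (x i.castSucc)) = a then u ^ queryFrequency x else 0 := by
    intro a
    by_cases ha : (fun i : Fin n => h (x i.castSucc)) = a
    · subst ha
      simp [assignmentWeight, queryFrequency, Finset.prod_ite]
    · rw [if_neg ha]
      obtain ⟨i, hi⟩ := Function.ne_iff.1 ha
      exact Finset.prod_eq_zero (Finset.mem_univ i) (if_neg hi)
  simp_rw [hw]
  rw [Finset.sum_ite_eq]
  congr 1
  simp only [sketchAssignments, Finset.mem_filter, Finset.mem_univ, true_and, eq_iff_iff]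
  exact funext_iff.symm

variable [MeasurableSpace S] [StandardBorelSpace S]

lemma measurable_assignmentWeight {h : S → Fin J} (hh : Measurable h) (u : ℝ)
    (a : Fin n → Fin J) :
    Measurable fun z : S × (Fin n → S) => assignmentWeight h u a z.1 z.2 := by
  unfold assignmentWeight
  refine Finset.measurable_prod _ fun i _ => ?_
  have hi : Measurable fun z : S × (Fin n → S) => z.2 i :=
    (measurable_pi_apply i).comp measurable_snd
  refine Measurable.ite ((hh.comp hi) (measurableSet_singleton _)) ?_ measurable_const
  exact Measurable.ite (measurableSet_eq_fun hi measurable_fst) measurable_const measurable_const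

omit [MeasurableSpace S] [StandardBorelSpace S] in
lemma abs_assignmentWeight_le (h : S → Fin J) {u : ℝ} (hu : |u| ≤ 1) (a : Fin n → Fin J) (s : S)
    (y : Fin n → S) : |assignmentWeight h u a s y| ≤ 1 := by
  classical
  rw [assignmentWeight, Finset.abs_prod]
  refine Finset.prod_le_one (fun i _ => abs_nonneg _) fun i _ => ?_
  split_ifs <;> simp [hu]

variable (P : Measure S) [IsProbabilityMeasure P]

open Classical in
lemma integral_bucketWeight {h : S → Fin J} (hh : Measurable h) (u : ℝ) (l : Fin J) (s : S) :
    ∫ x, (if h x = l then (if x = s then u else 1) else 0) ∂P =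
      bucketProb h P l - if h s = l then (1 - u) * P.real {s} else 0 := by
  have hl : MeasurableSet (h ⁻¹' {l}) := hh (measurableSet_singleton l)
  have h1 : ∀ x, (if h x = l then (if x = s then u else 1) else 0) =
      (h ⁻¹' {l}).indicator (fun _ => (1 : ℝ)) x -
        ({s} : Set S).indicator (fun _ => if h s = l then (1 - u) else 0) x := by
    intro x
    by_cases hx : x = s
    · subst hx
      by_cases hl : h x = l <;> simp [hl]
    · by_cases hl : h x = l <;> simp [hl, hx]
  simp_rw [h1]
  rw [integral_sub ((integrable_const _).indicator hl)
    ((integrable_const _).indicator (measurableSet_singleton s)), integral_indicator_const _ hl,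
    integral_indicator_const _ (measurableSet_singleton s)]
  simp only [bucketProb, smul_eq_mul, mul_one]
  split_ifs <;> ring

/-- The coordinates are independent and the result depends on `a` only through its counts `c`, so
all assignments contribute equally. The variable `u` enters only through the bucket of `s`. -/
lemma integral_assignmentWeight {h : S → Fin J}
    (hh : Measurable h) (u : ℝ) {c : Fin J → ℕ}
    {a : Fin n → Fin J} (ha : a ∈ sketchAssignments n c) (s : S) :
    ∫ y, assignmentWeight h u a s y ∂(Measure.pi fun _ : Fin n => P) =
      (bucketProb h P (h s) - (1 - u) * P.real {s}) ^ c (h s) *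
        ∏ l ∈ Finset.univ.erase (h s), bucketProb h P l ^ c l := by
  classical
  unfold assignmentWeight
  rw [integral_fintype_prod_eq_prod (μ := fun _ : Fin n => P)
    (f := fun i x => if h x = a i then (if x = s then u else 1) else (0 : ℝ))]
  simp_rw [integral_bucketWeight P hh]
  simp only [sketchAssignments, Finset.mem_filter, Finset.mem_univ, true_and] at ha
  rw [← Finset.prod_fiberwise (s := Finset.univ) (g := a)]
  have h1 : ∀ l, ∏ i ∈ Finset.univ.filter (fun i => a i = l),
      (bucketProb h P (a i) - if h s = a i then (1 - u) * P.real {s} else 0) =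
      (bucketProb h P l - if h s = l then (1 - u) * P.real {s} else 0) ^ c l := by
    intro l
    rw [← ha l]
    refine Finset.prod_eq_pow_card fun i hi => ?_
    rw [(Finset.mem_filter.1 hi).2]
  simp_rw [h1]
  rw [← Finset.mul_prod_erase _ _ (Finset.mem_univ (h s)), if_pos rfl]
  congr 1
  refine Finset.prod_congr rfl fun l hl => ?_
  rw [if_neg (Finset.ne_of_mem_erase hl).symm, sub_zero]

omit [IsProbabilityMeasure P] in
lemma measurable_measure_singleton [SFinite P] : Measurable fun s => P {s} := by
  have h1 := measurable_measure_prodMk_left (ν := P)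
    (measurableSet_eq_fun (measurable_fst (α := S) (β := S)) measurable_snd)
  convert! h1 using 3 with s
  ext t
  simp [eq_comm]

open Classical in
/-- The generating function of the frequency of the last symbol, on the event that the sketch is
`c` and that the last symbol is in bucket `j`. -/
lemma integral_sketch_pow_queryFrequency {h : S → Fin J} (hh : Measurable h) {u : ℝ}
    (hu : |u| ≤ 1) (c : Fin J → ℕ) (j : Fin J) :
    ∫ x, (if sketch h x = c ∧ h (x (Fin.last n)) = j then u ^ queryFrequency x else 0)
        ∂(Measure.pi fun _ : Fin (n + 1) => P) =
      (sketchAssignments n c).card * (∏ l ∈ Finset.univ.erase j, bucketProb h P l ^ c l) *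
        ∫ s in h ⁻¹' {j}, (bucketProb h P j - (1 - u) * P.real {s}) ^ c j ∂P := by
  let F : S × (Fin n → S) → ℝ := fun z =>
    if h z.1 = j then ∑ a ∈ sketchAssignments n c, assignmentWeight h u a z.1 z.2 else 0
  have hF : Measurable F := Measurable.ite ((hh.comp measurable_fst) (measurableSet_singleton j))
    (Finset.measurable_sum _ fun a _ => measurable_assignmentWeight hh u a) measurable_const
  have hFb : ∀ z, ‖F z‖ ≤ (sketchAssignments n c).card := by
    intro z
    simp only [F]
    split_ifs
    · rw [Real.norm_eq_abs]
      refine (Finset.abs_sum_le_sum_abs _ _).trans ?_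
      refine (Finset.sum_le_card_nsmul _ _ 1 fun a _ => abs_assignmentWeight_le h hu a _ _).trans ?_
      simp
    · simp
  have hFi : Integrable F (P.prod (Measure.pi fun _ : Fin n => P)) :=
    Integrable.of_bound hF.aestronglyMeasurable _ (ae_of_all _ hFb)
  have h1 : ∫ x, (if sketch h x = c ∧ h (x (Fin.last n)) = j then u ^ queryFrequency x else 0)
      ∂(Measure.pi fun _ : Fin (n + 1) => P) =
      ∫ z, F z ∂(P.prod (Measure.pi fun _ : Fin n => P)) := by
    -- Splits off the last symbol, so that the other `n` can be integrated with `X_{n+1} = s` held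
    -- fixed.
    rw [← (measurePreserving_piFinSuccAbove (fun _ : Fin (n + 1) => P)
      (Fin.last n)).integral_comp']
    refine integral_congr_ae (ae_of_all _ fun x => ?_)
    have h2 := sum_assignmentWeight h u c x
    have h3 : F (MeasurableEquiv.piFinSuccAbove (fun _ => S) (Fin.last n) x) =
        if h (x (Fin.last n)) = j then ∑ a ∈ sketchAssignments n c,
          assignmentWeight h u a (x (Fin.last n)) (fun i => x i.castSucc) else 0 := by
      simp only [F, MeasurableEquiv.piFinSuccAbove_apply]
      simp [Fin.insertNthEquiv]
      rfl
    simp only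
    rw [h3, h2]
    by_cases hj : h (x (Fin.last n)) = j <;> simp [hj]
  rw [h1, integral_prod _ hFi, ← integral_indicator (hh (measurableSet_singleton j)),
    ← integral_const_mul]
  refine integral_congr_ae (ae_of_all _ fun s => ?_)
  simp only [F]
  by_cases hj : h s = j
  · rw [indicator_of_mem (show s ∈ h ⁻¹' {j} from hj)]
    simp only [if_pos hj]
    rw [integral_finsetSum _ fun a _ => ?_,
      Finset.sum_congr rfl fun a ha => integral_assignmentWeight P hh u ha s, Finset.sum_const, hj,
      nsmul_eq_mul]
    · ring
    · exact Integrable.of_bound ((measurable_assignmentWeight hh u a).comp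
        (measurable_const.prodMk measurable_id)).aestronglyMeasurable 1
        (ae_of_all _ fun y => abs_assignmentWeight_le h hu a _ _)
  · rw [indicator_of_notMem (show s ∉ h ⁻¹' {j} from hj)]
    simp [hj]

lemma setIntegral_bucketProb_sub_pow {h : S → Fin J} (v : ℝ) (m : ℕ)
    (j : Fin J) :
    ∫ s in h ⁻¹' {j}, (bucketProb h P j - v * P.real {s}) ^ m ∂P =
      ∑ i ∈ Finset.range (m + 1), (m.choose i : ℝ) * (-v) ^ i * bucketProb h P j ^ (m - i) *
        (atomMoment h j i P).toReal := by
  have hmeas := measurable_measure_singleton P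
  have hM : ∀ i : ℕ, ∫ s in h ⁻¹' {j}, P.real {s} ^ i ∂P = (atomMoment h j i P).toReal := by
    intro i
    rw [atomMoment, ← integral_toReal (hmeas.pow_const i).aemeasurable
      (ae_of_all _ fun s => ENNReal.pow_lt_top (measure_lt_top P {s}))]
    simp [Measure.real, ENNReal.toReal_pow]
  have hexp : ∀ s, (bucketProb h P j - v * P.real {s}) ^ m =
      ∑ i ∈ Finset.range (m + 1), (m.choose i : ℝ) * (-v) ^ i * bucketProb h P j ^ (m - i) *
        P.real {s} ^ i := by
    intro s
    rw [show bucketProb h P j - v * P.real {s} = -v * P.real {s} + bucketProb h P j by ring, add_pow]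
    refine Finset.sum_congr rfl fun i _ => ?_
    rw [mul_pow]; ring
  simp_rw [hexp]
  rw [integral_finsetSum]
  · simp_rw [integral_const_mul, hM]
  · intro i _
    refine Integrable.const_mul ?_ _
    refine Integrable.of_bound (hmeas.ennreal_toReal.pow_const i).aestronglyMeasurable 1
      (ae_of_all _ fun s => ?_)
    rw [norm_pow, Real.norm_of_nonneg measureReal_nonneg]
    exact pow_le_one₀ measureReal_nonneg measureReal_le_one

omit [StandardBorelSpace S] in
lemma measurableSet_sketch {h : S → Fin J} (hh : Measurable h) (c : Fin J → ℕ) (j : Fin J) :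
    MeasurableSet {x : Fin (n + 1) → S | sketch h x = c ∧ h (x (Fin.last n)) = j} := by
  have h1 : Measurable fun (x : Fin (n + 1) → S) i => h (x i) :=
    measurable_pi_lambda _ fun i => hh.comp (measurable_pi_apply i)
  -- The event depends only on the hash values, which live in a finite discrete space.
  exact h1 (MeasurableSet.of_discrete (s := {b : Fin (n + 1) → Fin J |
    sketch id b = c ∧ b (Fin.last n) = j}))

lemma measurable_queryFrequency : Measurable (queryFrequency : (Fin (n + 1) → S) → ℕ) := by
  classical
  have h1 : (queryFrequency : (Fin (n + 1) → S) → ℕ) = fun x =>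
      ∑ i : Fin n, if x i.castSucc = x (Fin.last n) then 1 else 0 := by
    ext x
    rw [queryFrequency, Finset.card_filter]
  rw [h1]
  exact Finset.measurable_sum _ fun i _ => Measurable.ite
    (measurableSet_eq_fun (measurable_pi_apply _) (measurable_pi_apply _))
    measurable_const measurable_const

-- Equal symbols share a bucket; hence `r ≤ c j` exhausts the possible frequencies.
omit [MeasurableSpace S] [StandardBorelSpace S] in
lemma queryFrequency_le_sketch (h : S → Fin J) (x : Fin (n + 1) → S) :
    queryFrequency x ≤ sketch h x (h (x (Fin.last n))) := by
  classical
  unfold queryFrequency sketch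
  refine Finset.card_le_card fun i hi => ?_
  simp only [Finset.mem_filter, Finset.mem_univ, true_and] at hi ⊢
  rw [hi]

open Classical in
lemma sum_pow_mul_measureReal {h : S → Fin J} (hh : Measurable h) (u : ℝ) (c : Fin J → ℕ)
    (j : Fin J) :
    ∑ r ∈ Finset.range (c j + 1), u ^ r * (Measure.pi fun _ : Fin (n + 1) => P).real
        ({x | sketch h x = c ∧ h (x (Fin.last n)) = j} ∩ {x | queryFrequency x = r}) =
      ∫ x, (if sketch h x = c ∧ h (x (Fin.last n)) = j then u ^ queryFrequency x else 0)
        ∂(Measure.pi fun _ : Fin (n + 1) => P) := by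
  have hA := measurableSet_sketch (n := n) hh c j
  have hAr : ∀ r : ℕ, MeasurableSet ({x : Fin (n + 1) → S | sketch h x = c ∧
      h (x (Fin.last n)) = j} ∩ {x | queryFrequency x = r}) := fun r =>
    hA.inter (measurable_queryFrequency (measurableSet_singleton r))
  have hpt : ∀ x : Fin (n + 1) → S,
      (if sketch h x = c ∧ h (x (Fin.last n)) = j then u ^ queryFrequency x else 0) =
      ∑ r ∈ Finset.range (c j + 1), ({x | sketch h x = c ∧ h (x (Fin.last n)) = j} ∩
        {x | queryFrequency x = r}).indicator (fun _ => u ^ r) x := by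
    intro x
    by_cases hx : sketch h x = c ∧ h (x (Fin.last n)) = j
    · rw [if_pos hx, Finset.sum_eq_single (queryFrequency x)]
      · rw [indicator_of_mem]
        exact ⟨hx, rfl⟩
      · intro r _ hr
        rw [indicator_of_notMem]
        exact fun hmem => hr hmem.2.symm
      · intro hr
        have := queryFrequency_le_sketch h x
        rw [hx.1, hx.2] at this
        exact absurd (Finset.mem_range.2 (by omega)) hr
    · rw [if_neg hx, Finset.sum_eq_zero]
      intro r _
      rw [indicator_of_notMem]
      exact fun hmem => hx hmem.1
  simp_rw [hpt]
  rw [integral_finsetSum _ fun r _ => (integrable_const _).indicator (hAr r)]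
  refine Finset.sum_congr rfl fun r _ => ?_
  rw [integral_indicator_const _ (hAr r), smul_eq_mul, mul_comm]

/-- The generating function on the event divided by its value at `u = 1`, the probability of the
event. The factor `D`, common to both, cancels, and the `c j`-th power is expanded binomially. -/
lemma sum_pow_mul_frequencyProb {h : S → Fin J} (hh : Measurable h) {u : ℝ} (hu : |u| ≤ 1)
    {c : Fin J → ℕ} (hc : ∑ j, c j = n) (hq : ∀ j, bucketProb h P j ≠ 0) (j : Fin J) :
    ∑ r ∈ Finset.range (c j + 1), u ^ r * frequencyProb h n c j r P =
      ∑ i ∈ Finset.range (c j + 1), ((c j).choose i : ℝ) * (-1) ^ i * (1 - u) ^ i *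
        ((atomMoment h j i P).toReal / bucketProb h P j ^ (i + 1)) := by
  classical
  have hA := measurableSet_sketch (n := n) hh c j
  have hgen := fun (u : ℝ) (hu : |u| ≤ 1) => (sum_pow_mul_measureReal (n := n) P hh u c j).trans
    (integral_sketch_pow_queryFrequency P hh hu c j)
  have hone := integral_sketch_pow_queryFrequency (n := n) P hh (u := 1) (by simp) c j
  have hite : ∀ x : Fin (n + 1) → S, (if sketch h x = c ∧ h (x (Fin.last n)) = j then
      (1 : ℝ) ^ queryFrequency x else 0) =
      {x : Fin (n + 1) → S | sketch h x = c ∧ h (x (Fin.last n)) = j}.indicator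
        (fun _ => (1 : ℝ)) x := by
    intro x
    simp [indicator_apply]
  simp_rw [hite] at hone
  rw [integral_indicator_const _ hA, smul_eq_mul, mul_one] at hone
  simp only [sub_self, zero_mul, sub_zero, setIntegral_const, smul_eq_mul] at hone
  set D : ℝ := (sketchAssignments n c).card * (∏ l ∈ Finset.univ.erase j, bucketProb h P l ^ c l)
    with hDdef
  have hD : D ≠ 0 := by
    refine mul_ne_zero ?_ (Finset.prod_ne_zero_iff.2 fun l _ => pow_ne_zero _ (hq l))
    exact_mod_cast (Finset.card_pos.2 (sketchAssignments_nonempty hc)).ne'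
  have hqj := hq j
  have hfreq : ∀ r, frequencyProb h n c j r P =
      (D * (bucketProb h P j * bucketProb h P j ^ c j))⁻¹ *
        (Measure.pi fun _ : Fin (n + 1) => P).real
        ({x | sketch h x = c ∧ h (x (Fin.last n)) = j} ∩ {x | queryFrequency x = r}) := by
    intro r
    rw [frequencyProb, Measure.real, cond_apply hA, ENNReal.toReal_mul, ENNReal.toReal_inv]
    congr 2
  simp_rw [hfreq, mul_left_comm (u ^ _)]
  rw [← Finset.mul_sum, hgen u hu, setIntegral_bucketProb_sub_pow, Finset.mul_sum, Finset.mul_sum]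
  refine Finset.sum_congr rfl fun i hi => ?_
  have hi' : i ≤ c j := by rw [Finset.mem_range] at hi; omega
  have hpow : bucketProb h P j ^ c j = bucketProb h P j ^ (c j - i) * bucketProb h P j ^ i := by
    rw [← pow_add, Nat.sub_add_cancel hi']
  rw [hpow, neg_pow, pow_succ]
  field_simp

/-- The Good-Turing average of the frequency probabilities in terms of the atoms of `P`. -/
lemma sum_div_mul_frequencyProb {h : S → Fin J} (hh : Measurable h)
    {c : Fin J → ℕ} (hc : ∑ j, c j = n) (hq : ∀ j, bucketProb h P j ≠ 0) (j : Fin J) :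
    ∑ r ∈ Finset.range (c j + 1), 1 / ((r : ℝ) + 1) * frequencyProb h n c j r P =
      ∑ i ∈ Finset.range (c j + 1), ((c j).choose i : ℝ) * (-1) ^ i / (i + 1) *
        ((atomMoment h j i P).toReal / bucketProb h P j ^ (i + 1)) := by
  -- Integration over `[0, 1]` produces `1/(r+1)` from `u^r` on the left and `1/(i+1)` from
  -- `(1-u)^i` on the right.
  have h1 : ∫ u in (0 : ℝ)..1, ∑ r ∈ Finset.range (c j + 1), u ^ r * frequencyProb h n c j r P =
      ∫ u in (0 : ℝ)..1, ∑ i ∈ Finset.range (c j + 1),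
        ((c j).choose i : ℝ) * (-1) ^ i * (1 - u) ^ i *
          ((atomMoment h j i P).toReal / bucketProb h P j ^ (i + 1)) := by
    refine intervalIntegral.integral_congr fun u hu => ?_
    rw [uIcc_of_le zero_le_one] at hu
    exact sum_pow_mul_frequencyProb P hh (abs_le.2 ⟨by linarith [hu.1], hu.2⟩) hc hq j
  rw [intervalIntegral.integral_finsetSum, intervalIntegral.integral_finsetSum] at h1
  · convert h1 using 1
    · refine Finset.sum_congr rfl fun r _ => ?_
      rw [intervalIntegral.integral_mul_const, integral_pow]
      simp
    · refine Finset.sum_congr rfl fun i _ => ?_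
      rw [intervalIntegral.integral_mul_const, intervalIntegral.integral_const_mul,
        intervalIntegral.integral_comp_sub_left (fun u : ℝ => u ^ i) 1, integral_pow]
      simp only [sub_self, sub_zero, one_pow, zero_pow (Nat.succ_ne_zero _)]
      ring
  · intro i _
    exact Continuous.intervalIntegrable (by fun_prop) _ _
  · intro i _
    exact Continuous.intervalIntegrable (by fun_prop) _ _

end Sampling

/-! ### Recurrence of the digamma function. -/

section Digamma

lemma digamma_add_one {x : ℝ} (hx : 0 < x) : digamma (x + 1) = digamma x + 1 / x := by
  have hd : ∀ y : ℝ, 0 < y → DifferentiableAt ℝ (fun y : ℝ => Real.log (Real.Gamma y)) y := by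
    intro y hy
    refine (Real.differentiableAt_Gamma fun m => ?_).log (Real.Gamma_pos_of_pos hy).ne'
    have : (0 : ℝ) ≤ m := Nat.cast_nonneg m
    linarith
  have h1 : deriv (fun y : ℝ => Real.log (Real.Gamma (y + 1))) x = digamma (x + 1) :=
    deriv_comp_add_const (fun y : ℝ => Real.log (Real.Gamma y)) 1 x
  have h2 : (fun y : ℝ => Real.log (Real.Gamma (y + 1))) =ᶠ[nhds x]
      fun y => Real.log y + Real.log (Real.Gamma y) := by
    filter_upwards [lt_mem_nhds hx] with y hy
    rw [Real.Gamma_add_one hy.ne', Real.log_mul hy.ne' (Real.Gamma_pos_of_pos hy).ne']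
  rw [← h1, h2.deriv_eq, deriv_fun_add (Real.differentiableAt_log hx.ne') (hd x hx), Real.deriv_log,
    digamma, one_div, add_comm]

lemma digamma_nat_add_sub {x : ℝ} (hx : 0 < x) (m : ℕ) :
    digamma (m + x) - digamma x = ∑ i ∈ Finset.range m, 1 / (i + x) := by
  induction m with
  | zero => simp
  | succ m ih =>
    rw [Finset.sum_range_succ, ← ih, Nat.cast_succ, add_right_comm,
      digamma_add_one (by positivity)]
    ring

end Digamma

/-! ### Alternating binomial sums of the weight moments. -/

section WeightMoment

/-- Since `weightMoment α k = α ∫₀¹ t^k (1-t)^{α-1} dt`, the sum is `α ∫₀¹ t^a (1-t)^{α+m-1} dt`,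
again a Beta integral. The proof avoids integrals: Pascal's rule and induction on `m`, with `a`
general because one of the two halves is shifted to `a + 1`. -/
lemma sum_choose_mul_weightMoment {α : ℝ} (hα : 0 < α) (m a : ℕ) :
    ∑ r ∈ Finset.range (m + 1), (m.choose r : ℝ) * (-1) ^ r * weightMoment α (a + r) =
      α * a.factorial * Real.Gamma (α + m) / Real.Gamma (α + m + a + 1) := by
  induction m generalizing a with
  | zero => simp [weightMoment]
  | succ m ih =>
    have hsplit : ∑ r ∈ Finset.range (m + 1 + 1),
        ((m + 1).choose r : ℝ) * (-1) ^ r * weightMoment α (a + r) =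
        (∑ r ∈ Finset.range (m + 1), (m.choose r : ℝ) * (-1) ^ r * weightMoment α (a + r)) -
          ∑ r ∈ Finset.range (m + 1), (m.choose r : ℝ) * (-1) ^ r *
            weightMoment α (a + 1 + r) := by
      rw [Finset.sum_range_succ' _ (m + 1)]
      have h1 : ∑ r ∈ Finset.range (m + 1), (m.choose r : ℝ) * (-1) ^ r * weightMoment α (a + r) =
          ∑ r ∈ Finset.range (m + 1),
            (m.choose (r + 1) : ℝ) * (-1) ^ (r + 1) * weightMoment α (a + (r + 1)) +
          weightMoment α a := by
        rw [Finset.sum_range_succ', Finset.sum_range_succ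
          (fun r => (m.choose (r + 1) : ℝ) * (-1) ^ (r + 1) * weightMoment α (a + (r + 1)))]
        simp
      rw [h1, add_sub_right_comm, ← Finset.sum_sub_distrib]
      simp only [Nat.choose_zero_right, Nat.cast_one, pow_zero, mul_one, one_mul, add_zero]
      congr 1
      refine Finset.sum_congr rfl fun r _ => ?_
      rw [Nat.choose_succ_succ, show a + 1 + r = a + (r + 1) by ring]
      push_cast
      ring
    rw [hsplit, ih, ih]
    have hG1 : Real.Gamma (α + (m + 1 : ℕ)) = (α + m) * Real.Gamma (α + m) := by
      rw [← Real.Gamma_add_one (by positivity)]; push_cast; congr 1; ring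
    have hG2 : Real.Gamma (α + m + (a + 1 : ℕ) + 1) =
        (α + m + a + 1) * Real.Gamma (α + m + a + 1) := by
      rw [← Real.Gamma_add_one (by positivity)]; push_cast; congr 1; ring
    have hG3 : α + (m + 1 : ℕ) + a + 1 = α + m + (a + 1 : ℕ) + 1 := by push_cast; ring
    have hG := Real.Gamma_pos_of_pos (show 0 < α + m + a + 1 by positivity)
    rw [hG3, hG1, hG2, Nat.factorial_succ]
    push_cast
    field_simp
    ring

lemma sum_choose_div_mul_weightMoment {α : ℝ} (hα : 0 < α) (m : ℕ) :
    ∑ r ∈ Finset.range (m + 1), (m.choose r : ℝ) * (-1) ^ r / (r + 1) * weightMoment α r =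
      α / (1 + m) * (digamma (1 + m + α) - digamma α) := by
  have hD := digamma_nat_add_sub hα (m + 1)
  rw [show ((m + 1 : ℕ) : ℝ) + α = 1 + m + α by push_cast; ring] at hD
  rw [hD]
  have hm : (1 + m : ℝ) ≠ 0 := by positivity
  -- The factor `1/(r+1)` is absorbed by `(m+1) C(m, r) = (r+1) C(m+1, r+1)`. By Pascal's rule the
  -- sum then grows, from `m` to `m+1`, by the previous lemma at `a = 0`, that is by `α/(m+1+α)`.
  have h1 : ∀ m : ℕ, ∑ r ∈ Finset.range (m + 1),
      ((m + 1).choose (r + 1) : ℝ) * (-1) ^ r * weightMoment α r =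
      α * ∑ i ∈ Finset.range (m + 1), 1 / (i + α) := by
    intro m
    induction m with
    | zero =>
      have hG := Real.Gamma_pos_of_pos hα
      simp [weightMoment, Real.Gamma_add_one hα.ne']
      field_simp
    | succ m ih =>
      rw [Finset.sum_range_succ (fun i : ℕ => 1 / ((i : ℝ) + α)), mul_add, ← ih]
      have h2 := sum_choose_mul_weightMoment hα (m + 1) 0
      have hG := Real.Gamma_pos_of_pos (show 0 < α + (m + 1 : ℕ) by positivity)
      rw [Nat.cast_zero, add_zero, Real.Gamma_add_one (by positivity)] at h2
      have h3 : α * (1 / (((m + 1 : ℕ) : ℝ) + α)) =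
          α * (Nat.factorial 0) * Real.Gamma (α + (m + 1 : ℕ)) /
            ((α + (m + 1 : ℕ)) * Real.Gamma (α + (m + 1 : ℕ))) := by
        simp only [Nat.factorial_zero, Nat.cast_one, mul_one]
        field_simp
        ring
      rw [h3, ← h2]
      -- The added term is zero, since `C(m+1, m+2) = 0`.
      have h4 : ∑ r ∈ Finset.range (m + 1),
          ((m + 1).choose (r + 1) : ℝ) * (-1) ^ r * weightMoment α r =
          ∑ r ∈ Finset.range (m + 1 + 1),
          ((m + 1).choose (r + 1) : ℝ) * (-1) ^ r * weightMoment α r := by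
        rw [Finset.sum_range_succ _ (m + 1)]; simp
      rw [h4, ← Finset.sum_add_distrib]
      refine Finset.sum_congr rfl fun r _ => ?_
      rw [Nat.choose_succ_succ (m + 1) r, zero_add]
      push_cast
      ring
  rw [show α / (1 + m) * ∑ i ∈ Finset.range (m + 1), 1 / ((i : ℝ) + α) =
    (α * ∑ i ∈ Finset.range (m + 1), 1 / ((i : ℝ) + α)) / (1 + m) by ring, ← h1 m,
    Finset.sum_div]
  refine Finset.sum_congr rfl fun r _ => ?_
  have h5 : ((m + 1 : ℕ) : ℝ) * m.choose r = (m + 1).choose (r + 1) * ((r + 1 : ℕ) : ℝ) := by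
    exact_mod_cast Nat.add_one_mul_choose_eq m r
  push_cast at h5
  rw [show ((m + 1).choose (r + 1) : ℝ) = (m + 1) * m.choose r / (r + 1) by
    rw [eq_div_iff (by positivity), h5]]
  field_simp
  ring

end WeightMoment

/-! ### Strong universality forces equal bucket masses. -/

section Universality

variable {S : Type*} [MeasurableSpace S] {H : Type*} [MeasurableSpace H] {J : ℕ}

/-- Under strong universality, almost every hash function splits `G₀` evenly. -/
lemma IsStronglyUniversalFor.ae_measure_preimage {G₀ : Measure S} [IsProbabilityMeasure G₀]
    {lam : Measure H} [IsProbabilityMeasure lam] {h : H → S → Fin J}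
    (hmeas : Measurable (Function.uncurry h)) (huniv : IsStronglyUniversalFor lam h G₀)
    (hJ : 1 ≤ J) : ∀ᵐ ι ∂lam, ∀ j, G₀ (h ι ⁻¹' {j}) = (J : ℝ≥0∞)⁻¹ := by
  have hι : ∀ ι, Measurable (h ι) := fun ι => hmeas.comp measurable_prodMk_left
  have hJ0 : (J : ℝ) ≠ 0 := by positivity
  have hg : ∀ j, Measurable fun ι => G₀ (h ι ⁻¹' {j}) := fun j =>
    measurable_measure_prodMk_left (ν := G₀) (hmeas (measurableSet_singleton j))
  have hpair : ∀ j₁ j₂, ∫⁻ ι, G₀ (h ι ⁻¹' {j₁}) * G₀ (h ι ⁻¹' {j₂}) ∂lam =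
      ((J : ℝ≥0∞) ^ 2)⁻¹ := by
    intro j₁ j₂
    have h1 : Measurable fun z : H × S × S => h z.1 z.2.1 :=
      hmeas.comp (measurable_fst.prodMk (measurable_fst.comp measurable_snd))
    have h2 : Measurable fun z : H × S × S => h z.1 z.2.2 :=
      hmeas.comp (measurable_fst.prodMk (measurable_snd.comp measurable_snd))
    have hset : MeasurableSet {z : H × S × S | h z.1 z.2.1 = j₁ ∧ h z.1 z.2.2 = j₂} :=
      (h1 (measurableSet_singleton j₁)).inter (h2 (measurableSet_singleton j₂))
    rw [← huniv j₁ j₂, Measure.prod_apply hset]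
    refine lintegral_congr fun ι => ?_
    rw [← Measure.prod_prod]
    rfl
  rw [ae_all_iff]
  intro j
  -- The first moment comes from the pair law by summing over the second bucket.
  have hone : ∫⁻ ι, G₀ (h ι ⁻¹' {j}) ∂lam = (J : ℝ≥0∞)⁻¹ := by
    have h1 : ∀ ι, G₀ (h ι ⁻¹' {j}) = ∑ l, G₀ (h ι ⁻¹' {j}) * G₀ (h ι ⁻¹' {l}) := by
      intro ι
      rw [← Finset.mul_sum, ← measure_univ_eq_sum_preimage (hι ι) G₀, measure_univ, mul_one]
    rw [lintegral_congr h1, lintegral_finsetSum _ fun l _ =>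
      (show Measurable fun ι => G₀ (h ι ⁻¹' {j}) * G₀ (h ι ⁻¹' {l}) from (hg j).mul (hg l))]
    simp_rw [hpair]
    rw [Finset.sum_const, Finset.card_univ, Fintype.card_fin, nsmul_eq_mul, pow_two,
      ENNReal.mul_inv (by simp) (by simp), ← mul_assoc, ENNReal.mul_inv_cancel, one_mul]
    · exact_mod_cast (show J ≠ 0 by omega)
    · simp
  have hr1 : ∫ ι, G₀.real (h ι ⁻¹' {j}) ∂lam = (J : ℝ)⁻¹ := by
    have := integral_toReal (hg j).aemeasurable (ae_of_all lam fun ι => measure_lt_top G₀ _)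
    rw [hone] at this
    simpa [Measure.real] using this
  have hr2 : ∫ ι, G₀.real (h ι ⁻¹' {j}) ^ 2 ∂lam = ((J : ℝ) ^ 2)⁻¹ := by
    have := integral_toReal ((hg j).mul (hg j)).aemeasurable
      (ae_of_all lam fun ι => ENNReal.mul_lt_top (measure_lt_top G₀ _) (measure_lt_top G₀ _))
    simp only [Pi.mul_apply] at this
    rw [hpair] at this
    simpa [Measure.real, pow_two] using this
  have hm : Measurable fun ι => G₀.real (h ι ⁻¹' {j}) := (hg j).ennreal_toReal
  have hi1 : Integrable (fun ι => G₀.real (h ι ⁻¹' {j})) lam :=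
    Integrable.of_bound hm.aestronglyMeasurable 1 (ae_of_all _ fun ι => by
      rw [Real.norm_of_nonneg measureReal_nonneg]; exact measureReal_le_one)
  have hi2 : Integrable (fun ι => G₀.real (h ι ⁻¹' {j}) ^ 2) lam :=
    Integrable.of_bound (hm.pow_const 2).aestronglyMeasurable 1 (ae_of_all _ fun ι => by
      rw [norm_pow, Real.norm_of_nonneg measureReal_nonneg]
      exact pow_le_one₀ measureReal_nonneg measureReal_le_one)
  -- The variance is `1/J² - (1/J)² = 0`, so the bucket mass is almost surely constant.
  have hvar : ∫ ι, (G₀.real (h ι ⁻¹' {j}) - (J : ℝ)⁻¹) ^ 2 ∂lam = 0 := by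
    have h1 : ∀ ι, (G₀.real (h ι ⁻¹' {j}) - (J : ℝ)⁻¹) ^ 2 = G₀.real (h ι ⁻¹' {j}) ^ 2 -
        (2 * (J : ℝ)⁻¹ * G₀.real (h ι ⁻¹' {j}) - ((J : ℝ)⁻¹) ^ 2) := fun ι => by ring
    simp_rw [h1]
    have hi3 : Integrable (fun ι => 2 * (J : ℝ)⁻¹ * G₀.real (h ι ⁻¹' {j}) - ((J : ℝ)⁻¹) ^ 2) lam :=
      (hi1.const_mul _).sub (integrable_const _)
    rw [integral_sub hi2 hi3,
      integral_sub (hi1.const_mul _) (integrable_const _), integral_const_mul, hr1, hr2]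
    simp
    ring
  have hint : Integrable (fun ι => (G₀.real (h ι ⁻¹' {j}) - (J : ℝ)⁻¹) ^ 2) lam := by
    have h1 : (fun ι => (G₀.real (h ι ⁻¹' {j}) - (J : ℝ)⁻¹) ^ 2) =
        fun ι => G₀.real (h ι ⁻¹' {j}) ^ 2 -
        2 * (J : ℝ)⁻¹ * G₀.real (h ι ⁻¹' {j}) + ((J : ℝ)⁻¹) ^ 2 := by ext ι; ring
    rw [h1]
    exact (hi2.sub (hi1.const_mul _)).add (integrable_const _)
  rw [integral_eq_zero_iff_of_nonneg (fun ι => sq_nonneg _) hint] at hvar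
  filter_upwards [hvar] with ι h0
  have h2 : G₀.real (h ι ⁻¹' {j}) = (J : ℝ)⁻¹ := by
    have := pow_eq_zero_iff (two_ne_zero) |>.1 h0
    linarith
  rw [← ENNReal.ofReal_toReal (measure_ne_top G₀ _), ← Measure.real, h2,
    ENNReal.ofReal_inv_of_pos (by positivity), ENNReal.ofReal_natCast]

end Universality

/-! ### Transfer from the Gamma process to the Dirichlet law. -/

section Average

variable {S : Type*} [MeasurableSpace S] {J : ℕ}

lemma measurable_bucketProb {h : S → Fin J} (hh : Measurable h) :
    Measurable fun P : Measure S => bucketProb h P :=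
  measurable_pi_lambda _ fun j =>
    (Measure.measurable_coe (hh (measurableSet_singleton j))).ennreal_toReal

/-- Joint measurability of `(P, s) ↦ P {s}` is a fact about finite kernels. The identity kernel is
therefore cut to 0 at measures of mass above 1, which leaves probability measures unchanged. -/
lemma exists_measurable_eq_atomMoment [StandardBorelSpace S] {h : S → Fin J} (hh : Measurable h)
    (j : Fin J) (r : ℕ) : ∃ f : Measure S → ℝ≥0∞, Measurable f ∧
      ∀ P : Measure S, IsProbabilityMeasure P → f P = atomMoment h j r P := by
  classical
  have hset : MeasurableSet {P : Measure S | P univ ≤ 1} :=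
    measurableSet_le (Measure.measurable_coe MeasurableSet.univ) measurable_const
  let κ : Kernel (Measure S) S := ⟨fun P => if P univ ≤ 1 then P else 0,
    Measurable.ite hset measurable_id measurable_const⟩
  have hκ : IsFiniteKernel κ := ⟨1, ENNReal.one_lt_top, fun P => by
    change (if P univ ≤ 1 then P else 0 : Measure S) univ ≤ 1
    split_ifs with hP
    · exact hP
    · simp⟩
  have hκP : ∀ P : Measure S, IsProbabilityMeasure P → κ P = P := fun P _ => by
    change (if P univ ≤ 1 then P else 0 : Measure S) = P
    rw [if_pos prob_le_one]
  have hs : Measurable fun z : Measure S × S => κ z.1 {z.2} := by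
    have h1 := Kernel.measurable_kernel_prodMk_left (κ := κ.comap Prod.fst measurable_fst)
      (t := {x : (Measure S × S) × S | x.2 = x.1.2})
      (measurableSet_eq_fun measurable_snd (measurable_snd.comp measurable_fst))
    exact h1
  have hB : MeasurableSet (h ⁻¹' {j}) := hh (measurableSet_singleton j)
  refine ⟨fun P => ∫⁻ s, (h ⁻¹' {j}).indicator (fun s => κ P {s} ^ r) s ∂(κ P), ?_, ?_⟩
  · refine Measurable.lintegral_kernel_prod_right'
      (f := fun z : Measure S × S => (h ⁻¹' {j}).indicator (fun s => κ z.1 {s} ^ r) z.2) ?_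
    exact (Measurable.ite (measurable_snd hB) (hs.pow_const r) measurable_const)
  · intro P hP
    simp only [hκP P hP]
    rw [lintegral_indicator hB, atomMoment]

lemma measurable_normalized_jumpMeasure {Ω : Type*} [MeasurableSpace Ω] {p : ℕ → Ω → ℝ × S}
    (hp : ∀ k, Measurable (p k)) :
    Measurable fun ω => (jumpMeasure (fun k => p k ω) univ)⁻¹ • jumpMeasure fun k => p k ω := by
  have h1 : ∀ A, MeasurableSet A → Measurable fun ω => jumpMeasure (fun k => p k ω) A := by
    intro A hA
    have h2 : ∀ ω, jumpMeasure (fun k => p k ω) A =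
        ∑' k, ENNReal.ofReal (p k ω).1 * A.indicator 1 (p k ω).2 := by
      intro ω
      simp [jumpMeasure, Measure.sum_apply _ hA, Measure.dirac_apply' _ hA]
    simp_rw [h2]
    refine Measurable.tsum fun k => ?_
    have h3 : Measurable (A.indicator (1 : S → ℝ≥0∞)) := measurable_one.indicator hA
    exact (ENNReal.measurable_ofReal.comp (measurable_fst.comp (hp k))).mul
      (h3.comp (measurable_snd.comp (hp k)))
  refine Measure.measurable_of_measurable_coe _ fun A hA => ?_
  simp only [Measure.smul_apply, smul_eq_mul]
  exact (h1 univ MeasurableSet.univ).inv.mul (h1 A hA)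

variable [StandardBorelSpace S] {θ α : ℝ} {G₀ : Measure S} [IsFiniteMeasure G₀]
  [NullSingletonClass G₀] {h : S → Fin J} {w : ℝ≥0∞}

/-- The normalized moments `∑ P{s} ^ (r + 1) / q_j ^ (r + 1)` of a Dirichlet process over the
bucket `j` have mean `weightMoment α r`, conditionally on the bucket probabilities. -/
lemma IsDirichletProcessLaw.integral_atomMoment_mul {Q : Measure (Measure S)}
    (hQ : IsDirichletProcessLaw θ G₀ Q) (hJ : 1 ≤ J) (hh : Measurable h)
    (hG : ∀ j, G₀ (h ⁻¹' {j}) = w) (hw : ENNReal.ofReal θ * w = ENNReal.ofReal α) (hα : 0 < α) :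
    IsProbabilityMeasure Q ∧
    (∀ᵐ P ∂Q, IsProbabilityMeasure P ∧ ∀ j, bucketProb h P j ≠ 0) ∧
    ∀ (j : Fin J) (r : ℕ) (φ : (Fin J → ℝ) → ℝ), Measurable φ →
      (∀ x, (∀ l, 0 ≤ x l ∧ x l ≤ 1) → 0 ≤ φ x ∧ φ x ≤ 1) →
      Integrable (fun P => (atomMoment h j r P).toReal / bucketProb h P j ^ (r + 1) *
        φ (bucketProb h P)) Q ∧
      ∫ P, (atomMoment h j r P).toReal / bucketProb h P j ^ (r + 1) * φ (bucketProb h P) ∂Q =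
        weightMoment α r * ∫ P, φ (bucketProb h P) ∂Q := by
  obtain ⟨Ω, _, μ, _, p, hp, hN, rfl⟩ := hQ
  have hΦ := measurable_normalized_jumpMeasure hp
  set Φ : Ω → Measure S :=
    fun ω => (jumpMeasure (fun k => p k ω) univ)⁻¹ • jumpMeasure fun k => p k ω with hΦdef
  set N : Ω → Measure (ℝ × S) := fun ω => pointMeasure fun k => p k ω with hNdef
  have hT := measurable_bucketMass hN hh
  have hmass : ∀ᵐ ω ∂μ, ∀ j, jumpMeasure (fun k => p k ω) (h ⁻¹' {j}) = bucketMass N h ω j := by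
    filter_upwards [ae_coe_bucketMass hN hh hG hw hα] with ω hω j
    rw [hω, jumpMeasure_preimage _ hh]
  have htot : ∀ᵐ ω ∂μ, jumpMeasure (fun k => p k ω) univ ≠ 0 ∧
      jumpMeasure (fun k => p k ω) univ ≠ ∞ := by
    filter_upwards [hmass, ae_bucketMass_ne_zero hN hh hG hw hα] with ω h1 h2
    rw [measure_univ_eq_sum_preimage hh]
    simp_rw [h1]
    refine ⟨fun h0 => h2 ⟨0, hJ⟩ ?_, ENNReal.sum_ne_top.2 fun _ _ => ENNReal.coe_ne_top⟩
    simpa using (Finset.sum_eq_zero_iff.1 h0) ⟨0, hJ⟩ (Finset.mem_univ _)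
  have hprob : ∀ᵐ ω ∂μ, IsProbabilityMeasure (Φ ω) := by
    filter_upwards [htot] with ω hω
    exact ⟨by simpa [hΦdef] using ENNReal.inv_mul_cancel hω.1 hω.2⟩
  have hbucket : ∀ᵐ ω ∂μ, bucketProb h (Φ ω) =
      fun j => (bucketMass N h ω j : ℝ) / ∑ l, (bucketMass N h ω l : ℝ) := by
    filter_upwards [hmass] with ω hω
    ext j
    rw [bucketProb, Measure.real, hΦdef]
    simp only [Measure.smul_apply, smul_eq_mul]
    rw [measure_univ_eq_sum_preimage hh]
    simp_rw [hω]
    rw [ENNReal.toReal_mul, ENNReal.toReal_inv, ENNReal.toReal_sum fun _ _ => ENNReal.coe_ne_top]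
    simp only [ENNReal.coe_toReal]
    rw [div_eq_inv_mul]
  have hgood : ∀ᵐ P ∂(μ.map Φ), IsProbabilityMeasure P ∧ ∀ j, bucketProb h P j ≠ 0 := by
    have hset : MeasurableSet {P : Measure S | P univ = 1 ∧ ∀ j, bucketProb h P j ≠ 0} := by
      refine (Measure.measurable_coe MeasurableSet.univ (measurableSet_singleton 1)).inter
        ((MeasurableSet.iInter fun j => ((measurable_pi_apply j).comp (measurable_bucketProb hh))
          (measurableSet_singleton 0).compl).congr ?_)
      ext P
      simp only [mem_iInter]
      rfl
    have h1 : ∀ᵐ P ∂(μ.map Φ), P univ = 1 ∧ ∀ j, bucketProb h P j ≠ 0 := by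
      rw [ae_map_iff hΦ.aemeasurable hset]
      filter_upwards [hprob, hbucket, ae_bucketMass_ne_zero hN hh hG hw hα] with ω h1 h2 h3
      refine ⟨h1.measure_univ, fun j => ?_⟩
      rw [h2]
      refine div_ne_zero (by exact_mod_cast h3 j) (ne_of_gt ?_)
      exact Finset.sum_pos (fun l _ => by exact_mod_cast pos_iff_ne_zero.2 (h3 l))
        ⟨j, Finset.mem_univ j⟩
    filter_upwards [h1] with P hP
    exact ⟨⟨hP.1⟩, hP.2⟩
  refine ⟨Measure.isProbabilityMeasure_map hΦ.aemeasurable, hgood, fun j r φ hφ hφ01 => ?_⟩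
  let X : Ω → ℝ≥0∞ := fun ω =>
    (∫⁻ x, jumpPower h j (r + 1) x ∂(N ω)) / (bucketMass N h ω j : ℝ≥0∞) ^ (r + 1)
  have hX : ∀ᵐ ω ∂μ, (atomMoment h j r (Φ ω)).toReal / bucketProb h (Φ ω) j ^ (r + 1) =
      (X ω).toReal := by
    filter_upwards [htot, hmass, ae_locations_ne hN] with ω h1 h2 h3
    rw [bucketProb, Measure.real, ← ENNReal.toReal_pow, ← ENNReal.toReal_div, hΦdef,
      atomMoment_smul_div h j r _ (ENNReal.inv_ne_zero.2 h1.2) (ENNReal.inv_ne_top.2 h1.1),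
      atomMoment_jumpMeasure h3 hh, h2]
  -- Bucket probabilities are a function of the bucket masses, so a statement conditional on the
  -- masses descends to one conditional on `q(P)`.
  let ψ : (Fin J → ℝ≥0) → Fin J → ℝ := fun t j => (t j : ℝ) / ∑ l, (t l : ℝ)
  have hψ : Measurable ψ := by
    refine measurable_pi_lambda _ fun j => ?_
    fun_prop
  -- Holds for every `t`: if all masses vanish, division by zero returns 0, which is still in the
  -- cube where `φ` is controlled.
  have hψ01 : ∀ t l, 0 ≤ ψ t l ∧ ψ t l ≤ 1 := by
    intro t l
    have h0 : (0 : ℝ) ≤ ∑ l, (t l : ℝ) := Finset.sum_nonneg fun _ _ => NNReal.coe_nonneg _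
    refine ⟨div_nonneg (NNReal.coe_nonneg _) h0, div_le_one_of_le₀ ?_ h0⟩
    exact Finset.single_le_sum (f := fun l => (t l : ℝ)) (fun _ _ => NNReal.coe_nonneg _)
      (Finset.mem_univ l)
  have hmX : Measurable X := by
    have := hN.measurable_lintegral (measurable_jumpPower hh j (r + 1))
    fun_prop
  have hkey := lintegral_jumpPower_div_mul hN hh hG hw hα j r
    (φ := fun t => ENNReal.ofReal (φ (ψ t))) (by fun_prop)
  have hfin : ∫⁻ ω, ENNReal.ofReal (φ (ψ (bucketMass N h ω))) ∂μ ≠ ∞ := by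
    refine ne_top_of_le_ne_top ENNReal.one_ne_top ((lintegral_mono fun ω =>
      ENNReal.ofReal_le_ofReal (hφ01 _ (hψ01 _)).2).trans ?_)
    simp
  have hfinX : ∫⁻ ω, X ω * ENNReal.ofReal (φ (ψ (bucketMass N h ω))) ∂μ ≠ ∞ := by
    rw [hkey]; exact ENNReal.mul_ne_top ENNReal.ofReal_ne_top hfin
  have hmZ : Measurable fun ω => X ω * ENNReal.ofReal (φ (ψ (bucketMass N h ω))) := by fun_prop
  have hcongr : (fun ω => (atomMoment h j r (Φ ω)).toReal / bucketProb h (Φ ω) j ^ (r + 1) *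
      φ (bucketProb h (Φ ω))) =ᵐ[μ]
      fun ω => (X ω * ENNReal.ofReal (φ (ψ (bucketMass N h ω)))).toReal := by
    filter_upwards [hX, hbucket] with ω h1 h2
    rw [h1, h2, ENNReal.toReal_mul, ENNReal.toReal_ofReal (hφ01 _ (hψ01 _)).1]
  have hmeas : AEStronglyMeasurable (fun P => (atomMoment h j r P).toReal /
      bucketProb h P j ^ (r + 1) * φ (bucketProb h P)) (μ.map Φ) := by
    obtain ⟨f, hf, hfP⟩ := exists_measurable_eq_atomMoment hh j r
    have hq := measurable_bucketProb hh
    refine AEMeasurable.aestronglyMeasurable ⟨fun P => (f P).toReal /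
      bucketProb h P j ^ (r + 1) * φ (bucketProb h P), ?_, ?_⟩
    · exact (hf.ennreal_toReal.div (((measurable_pi_apply j).comp hq).pow_const _)).mul (hφ.comp hq)
    · filter_upwards [hgood] with P hP
      rw [hfP P hP.1]
  refine ⟨?_, ?_⟩
  · rw [integrable_map_measure hmeas hΦ.aemeasurable]
    exact (integrable_toReal_of_lintegral_ne_top hmZ.aemeasurable hfinX).congr hcongr.symm
  · rw [integral_map hΦ.aemeasurable hmeas, integral_congr_ae hcongr,
      integral_toReal hmZ.aemeasurable (ae_lt_top hmZ hfinX), hkey, ENNReal.toReal_mul,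
      ENNReal.toReal_ofReal (weightMoment_nonneg hα r),
      integral_map (f := fun P => φ (bucketProb h P)) hΦ.aemeasurable
        (hφ.comp (measurable_bucketProb hh)).aestronglyMeasurable]
    congr 1
    rw [← integral_toReal (by fun_prop) (ae_of_all _ fun ω => ENNReal.ofReal_lt_top)]
    refine integral_congr_ae ?_
    filter_upwards [hbucket] with ω h2
    rw [h2, ENNReal.toReal_ofReal (hφ01 _ (hψ01 _)).1]

end Average

/-! ### The two forms of the smoothed estimator. -/

section Estimator

variable {S : Type*} [MeasurableSpace S] [StandardBorelSpace S] {J n : ℕ} {θ α : ℝ}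
  {G₀ : Measure S} [IsFiniteMeasure G₀] [NullSingletonClass G₀] {h : S → Fin J} {w : ℝ≥0∞}

/-- The Good-Turing average of the frequency probabilities in a bucket has a constant mean,
conditionally on the bucket probabilities. -/
lemma IsDirichletProcessLaw.integral_sum_frequencyProb_mul {Q : Measure (Measure S)}
    (hQ : IsDirichletProcessLaw θ G₀ Q) (hJ : 1 ≤ J) (hh : Measurable h)
    (hG : ∀ j, G₀ (h ⁻¹' {j}) = w) (hw : ENNReal.ofReal θ * w = ENNReal.ofReal α) (hα : 0 < α)
    {c : Fin J → ℕ} (hc : ∑ j, c j = n) (j : Fin J) {φ : (Fin J → ℝ) → ℝ} (hφ : Measurable φ)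
    (hφ01 : ∀ x, (∀ l, 0 ≤ x l ∧ x l ≤ 1) → 0 ≤ φ x ∧ φ x ≤ 1) :
    Integrable (fun P => (∑ r ∈ Finset.range (c j + 1),
        1 / ((r : ℝ) + 1) * frequencyProb h n c j r P) * φ (bucketProb h P)) Q ∧
      ∫ P, (∑ r ∈ Finset.range (c j + 1),
        1 / ((r : ℝ) + 1) * frequencyProb h n c j r P) * φ (bucketProb h P) ∂Q =
        α / (1 + c j) * (digamma (1 + c j + α) - digamma α) * ∫ P, φ (bucketProb h P) ∂Q := by
  obtain ⟨_, hgood, hint⟩ := hQ.integral_atomMoment_mul hJ hh hG hw hα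
  have hcongr : (fun P => (∑ r ∈ Finset.range (c j + 1),
      1 / ((r : ℝ) + 1) * frequencyProb h n c j r P) * φ (bucketProb h P)) =ᵐ[Q]
      fun P => ∑ i ∈ Finset.range (c j + 1), ((c j).choose i : ℝ) * (-1) ^ i / (i + 1) *
        ((atomMoment h j i P).toReal / bucketProb h P j ^ (i + 1) * φ (bucketProb h P)) := by
    filter_upwards [hgood] with P hP
    have := hP.1
    rw [sum_div_mul_frequencyProb P hh hc hP.2 j, Finset.sum_mul]
    exact Finset.sum_congr rfl fun i _ => by ring
  have hi : ∀ i ∈ Finset.range (c j + 1), Integrable (fun P =>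
      ((c j).choose i : ℝ) * (-1) ^ i / (i + 1) *
        ((atomMoment h j i P).toReal / bucketProb h P j ^ (i + 1) * φ (bucketProb h P))) Q :=
    fun i _ => (hint j i φ hφ hφ01).1.const_mul _
  refine ⟨(integrable_finsetSum _ hi).congr hcongr.symm, ?_⟩
  rw [integral_congr_ae hcongr, integral_finsetSum _ hi, ← sum_choose_div_mul_weightMoment hα,
    Finset.sum_mul]
  refine Finset.sum_congr rfl fun i _ => ?_
  rw [integral_const_mul, (hint j i φ hφ hφ01).2]
  ring

/-- The mean of the cardinality functional under the Dirichlet process, at fixed bucket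
probabilities. -/
lemma IsDirichletProcessLaw.integral_cardinalityFunctional {Q : Measure (Measure S)}
    (hQ : IsDirichletProcessLaw θ G₀ Q) (hJ : 1 ≤ J) (hh : Measurable h)
    (hG : ∀ j, G₀ (h ⁻¹' {j}) = w) (hw : ENNReal.ofReal θ * w = ENNReal.ofReal α) (hα : 0 < α)
    {c : Fin J → ℕ} (hc : ∑ j, c j = n) (q : Fin J → ℝ) :
    Integrable (fun P => cardinalityFunctional h n c q P) Q ∧
      ∫ P, cardinalityFunctional h n c q P ∂Q =
        n * α * ∑ j, q j / (1 + c j) * (digamma (1 + c j + α) - digamma α) := by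
  have := (hQ.integral_atomMoment_mul hJ hh hG hw hα).1
  -- Fixed `q` corresponds to the trivial test function `φ = 1`.
  have hone := fun j => hQ.integral_sum_frequencyProb_mul hJ hh hG hw hα hc j
    (φ := fun _ => 1) measurable_const fun _ _ => ⟨zero_le_one, le_rfl⟩
  simp only [mul_one, integral_const, probReal_univ, smul_eq_mul] at hone
  unfold cardinalityFunctional
  refine ⟨(integrable_finsetSum _ fun j _ => (hone j).1.const_mul _).const_mul _, ?_⟩
  rw [integral_const_mul, integral_finsetSum _ fun j _ => (hone j).1.const_mul _, mul_assoc]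
  congr 1
  rw [Finset.mul_sum]
  refine Finset.sum_congr rfl fun j _ => ?_
  rw [integral_const_mul, (hone j).2]
  ring

/-- The conditional mean of the cardinality functional under the Dirichlet process, given the
bucket probabilities. -/
lemma IsDirichletProcessLaw.condExp_epsilonK {Q : Measure (Measure S)}
    (hQ : IsDirichletProcessLaw θ G₀ Q) (hJ : 1 ≤ J) (hh : Measurable h)
    (hG : ∀ j, G₀ (h ⁻¹' {j}) = w) (hw : ENNReal.ofReal θ * w = ENNReal.ofReal α) (hα : 0 < α)
    {c : Fin J → ℕ} (hc : ∑ j, c j = n) :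
    Integrable (fun P => epsilonK h n c P) Q ∧
      Q[fun P => epsilonK h n c P | MeasurableSpace.comap (bucketProb h) inferInstance] =ᵐ[Q]
        fun P => n * α * ∑ j, bucketProb h P j / (1 + c j) *
          (digamma (1 + c j + α) - digamma α) := by
  obtain ⟨_, hgood, -⟩ := hQ.integral_atomMoment_mul hJ hh hG hw hα
  have hq := measurable_bucketProb hh
  -- The weight `q_j(P)` in `epsilonK` is itself a function of the conditioning vector, so `φ(x) =
  -- 1_D(x) x_j` tests the conditional expectation on the event `q(P) ∈ D`.
  have hterm := fun (D : Set (Fin J → ℝ)) (hD : MeasurableSet D) j =>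
    hQ.integral_sum_frequencyProb_mul hJ hh hG hw hα hc j
      (φ := D.indicator fun x => x j) ((measurable_pi_apply j).indicator hD) fun x hx => by
        by_cases hxD : x ∈ D
        · simpa [hxD] using hx j
        · simp [hxD]
  have hqi : ∀ j, Integrable (fun P => bucketProb h P j) Q := fun j =>
    Integrable.of_bound ((measurable_pi_apply j).comp hq).aestronglyMeasurable 1 (by
      filter_upwards [hgood] with P hP
      have := hP.1
      rw [bucketProb, Real.norm_of_nonneg measureReal_nonneg]
      exact measureReal_le_one)
  have hfun : (fun P => epsilonK h n c P) = fun P => (n : ℝ) * ∑ j,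
      (∑ r ∈ Finset.range (c j + 1), 1 / ((r : ℝ) + 1) * frequencyProb h n c j r P) *
        bucketProb h P j := by
    ext P
    rw [epsilonK, cardinalityFunctional]
    congr 1
    exact Finset.sum_congr rfl fun j _ => mul_comm _ _
  have hti : ∀ j, Integrable (fun P => (∑ r ∈ Finset.range (c j + 1),
      1 / ((r : ℝ) + 1) * frequencyProb h n c j r P) * bucketProb h P j) Q := fun j => by
    simpa using (hterm univ MeasurableSet.univ j).1
  have hint : Integrable (fun P => epsilonK h n c P) Q := by
    rw [hfun]
    exact (integrable_finsetSum _ fun j _ => hti j).const_mul _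
  have hgi : Integrable (fun P => n * α * ∑ j, bucketProb h P j / (1 + c j) *
      (digamma (1 + c j + α) - digamma α)) Q :=
    (integrable_finsetSum _ fun j _ => ((hqi j).div_const _).mul_const _).const_mul _
  refine ⟨hint, ?_⟩
  refine (ae_eq_condExp_of_forall_setIntegral_eq hq.comap_le hint
    (fun s _ _ => hgi.integrableOn) ?_ ?_).symm
  · rintro s ⟨D, hD, rfl⟩ -
    have hs : MeasurableSet (bucketProb h ⁻¹' D : Set (Measure S)) := hq hD
    rw [integral_const_mul, integral_finsetSum _ fun j _ =>
      (((hqi j).div_const _).mul_const _).integrableOn, hfun, integral_const_mul,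
      integral_finsetSum _ fun j _ => (hti j).integrableOn, mul_assoc]
    congr 1
    rw [Finset.mul_sum]
    refine Finset.sum_congr rfl fun j _ => ?_
    have h1 := (hterm D hD j).2
    have h2 : ∀ P : Measure S, D.indicator (fun x => x j) (bucketProb h P) =
        (bucketProb h ⁻¹' D : Set (Measure S)).indicator (fun P => bucketProb h P j) P :=
      fun P => rfl
    have h3 : ∀ P : Measure S, (∑ r ∈ Finset.range (c j + 1),
        1 / ((r : ℝ) + 1) * frequencyProb h n c j r P) * D.indicator (fun x => x j)
          (bucketProb h P) = (bucketProb h ⁻¹' D : Set (Measure S)).indicator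
        (fun P => (∑ r ∈ Finset.range (c j + 1),
          1 / ((r : ℝ) + 1) * frequencyProb h n c j r P) * bucketProb h P j) P := fun P => by
      rw [h2]
      exact (indicator_mul_right _ (fun P => ∑ r ∈ Finset.range (c j + 1),
        1 / ((r : ℝ) + 1) * frequencyProb h n c j r P) (fun P => bucketProb h P j)).symm
    rw [integral_congr_ae (ae_of_all _ h3), integral_congr_ae (ae_of_all _ h2),
      integral_indicator hs, integral_indicator hs] at h1
    rw [h1, integral_mul_const, integral_div]
    ring
  · have hm : Measurable fun x : Fin J → ℝ => n * α * ∑ j, x j / (1 + c j) *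
        (digamma (1 + c j + α) - digamma α) := by fun_prop
    exact (hm.comp (comap_measurable (bucketProb h))).aestronglyMeasurable

end Estimator

end SketchDP

end

open SketchDP
theorem proposition4
    {S : Type*} [MeasurableSpace S] [StandardBorelSpace S]
    {H : Type*} [MeasurableSpace H]
    (n J : ℕ) (hn : 1 ≤ n) (hJ : 1 ≤ J)
    (θ : ℝ) (hθ : 0 < θ)
    (G₀ : Measure S) [IsProbabilityMeasure G₀] [NullSingletonClass G₀]
    (lam : Measure H) [IsProbabilityMeasure lam]
    (h : H → S → Fin J) (hmeas : Measurable (Function.uncurry h))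
    (huniv : IsStronglyUniversalFor lam h G₀)
    (Q : Measure (Measure S)) (hQ : IsDirichletProcessLaw θ G₀ Q)
    (c : Fin J → ℕ) (hc : ∑ j, c j = n) :
    ∀ᵐ ι ∂lam,
      (∀ q : Fin J → ℝ,
        Integrable (fun P => cardinalityFunctional (h ι) n c q P) Q ∧
        ∫ P, cardinalityFunctional (h ι) n c q P ∂Q =
          n * (θ / J) * ∑ j, q j / (1 + c j) *
            (digamma (1 + c j + θ / J) - digamma (θ / J))) ∧
      (Integrable (fun P => epsilonK (h ι) n c P) Q ∧
        Q[fun P => epsilonK (h ι) n c P |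
            MeasurableSpace.comap (bucketProb (h ι)) inferInstance] =ᵐ[Q]
          fun P => n * (θ / J) * ∑ j, bucketProb (h ι) P j / (1 + c j) *
            (digamma (1 + c j + θ / J) - digamma (θ / J))) := by
  have hJ' : (0 : ℝ) < J := by exact_mod_cast hJ
  -- The Gamma shape of each bucket is `θ` times its `G₀`-mass.
  have hw : ENNReal.ofReal θ * (J : ℝ≥0∞)⁻¹ = ENNReal.ofReal (θ / J) := by
    rw [ENNReal.ofReal_div_of_pos hJ', ENNReal.ofReal_natCast, div_eq_mul_inv]
  filter_upwards [huniv.ae_measure_preimage hmeas hJ] with ι hι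
  have hh : Measurable (h ι) := hmeas.comp measurable_prodMk_left
  exact ⟨fun q => hQ.integral_cardinalityFunctional hJ hh hι hw (div_pos hθ hJ') hc q,
    hQ.condExp_epsilonK hJ hh hι hw (div_pos hθ hJ') hc⟩
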